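/- Theorem 1.6. Let $n\ge 2$ and $1\le k\le n-2$, let $\Omega\subset\mathbb R^n$ be a domain (connected open set), and let $E\subset\Omega$ be a smooth closed (i.e. compact, without boundary) embedded submanifold of dimension $k$. Let $\mathcal S^{n\times n}$ be the space of real symmetric $n\times n$ matrices, with eigenvalues ordered $\lambda_1\le\dots\le\lambda_n$, and let $U\subset\mathcal S^{n\times n}$ be an open subset satisfying (cone condition) $M+N\in U$ for all $M\in U$ and all positive definite $N\in\mathcal S^{n\times n}$; (Property $P_k$) for every $C>0$ there exist $\bar\delta,\bar\epsilon>0$ such that $M+\epsilon N\in U$ whenever $0<\epsilon<\bar\epsilon$, $M\in\overline U$, $M\le CI$, and $N\in\mathcal S^{n\times n}$ satisfies $\lambda_i(N)=-\bar\delta$ for $1\le i\le k$ and $\lambda_j(N)=1$ for $k+1\le j\le n$. Let $\widetilde L:\mathbb R^n\times\mathbb R\times\mathbb R^n\to\mathcal S^{n\times n}$ be locally Lipschitz ($C^{0,1}_{loc}$), and for a $C^2$ function $w$ put $\widetilde A^w:=-\nabla^2w+\widetilde L(\cdot,w,\nabla w)$. Assume that $u\in C^2(\Omega\setminus E)$ and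 $v\in C^2(\Omega)$ satisfy $$\lambda_1(\nabla^2u)+\dots+\lambda_{k+2}(\nabla^2u)\le 0\ \text{ in }\Omega\setminus E,$$ $$\widetilde A^u\in\overline U\ \text{ in }\Omega\setminus E,\qquad \widetilde A^v\in\mathcal S^{n\times n}\setminus U\ \text{ in }\Omega,\qquad u>v\ \text{ in }\Omega\setminus E.$$ Then $$\liminf_{x\in\Omega\setminus E,\ \mathrm{dist}(x,E)\to0}(u-v)(x)>0.$$ -/

import Mathlib

open Set Filter Topology
open scoped ContDiff

/-- `n`-dimensional Euclidean space `ℝⁿ`. -/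
abbrev Eucl (n : ℕ) : Type := EuclideanSpace ℝ (Fin n)

/-- Real `n × n` matrices. -/
abbrev Mat (n : ℕ) : Type := Matrix (Fin n) (Fin n) ℝ

/-- The set `𝒮ⁿˣⁿ` of real symmetric `n × n` matrices. -/
def symMat (n : ℕ) : Set (Mat n) := {M | M.IsSymm}

/-- `U` is an open subset of the space `𝒮ⁿˣⁿ` (with its subspace topology). -/
def IsOpenInSym {n : ℕ} (U : Set (Mat n)) : Prop :=
  ∃ O : Set (Mat n), IsOpen O ∧ U = O ∩ symMat n

/-- The Hessian `∇²u(x)`, the matrix of second partial derivatives `∂ᵢ∂ⱼu(x)`. -/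
noncomputable def hessMat {n : ℕ} (u : Eucl n → ℝ) (x : Eucl n) : Mat n :=
  Matrix.of fun i j =>
    fderiv ℝ (fun y => fderiv ℝ u y (EuclideanSpace.single j 1)) x (EuclideanSpace.single i 1)

open Classical in
/-- The eigenvalues `λ₁(M) ≤ ⋯ ≤ λₙ(M)` of a symmetric matrix `M`, with multiplicity and in
increasing order; `lam M i` is `λ_{i+1}(M)`, since `i : Fin n` starts at `0`.
(Mathlib lists the eigenvalues in decreasing order.) The value for a matrix that
is not symmetric is irrelevant and set to `0`. -/
noncomputable def lam {n : ℕ} (M : Mat n) (i : Fin n) : ℝ :=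
  if h : M.IsHermitian then h.eigenvalues₀ (Fin.cast (Fintype.card_fin n).symm i.rev) else 0

/-- `λ₁(M) + ⋯ + λ_m(M)`, for `m ≤ n`. -/
noncomputable def lamSum {n : ℕ} (m : ℕ) (M : Mat n) : ℝ :=
  ∑ i : Fin n with i.val < m, lam M i

/-- `E ⊆ ℝⁿ` is a smooth closed submanifold of dimension `k`: it is compact and near each of
its points some smooth change of coordinates of `ℝⁿ` straightens it to the coordinate
`k`-plane `{y | y_{k+1} = ⋯ = y_n = 0}` (so that there is no boundary). -/
structure IsSmoothClosedSubmanifold {n : ℕ} (k : ℕ) (E : Set (Eucl n)) : Prop where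
  isCompact : IsCompact E
  exists_slice : ∀ p ∈ E, ∃ φ : OpenPartialHomeomorph (Eucl n) (Eucl n),
    p ∈ φ.source ∧ ContDiffOn ℝ ∞ φ φ.source ∧ ContDiffOn ℝ ∞ φ.symm φ.target ∧
      ∀ x ∈ φ.source, x ∈ E ↔ ∀ i : Fin n, k ≤ i.val → φ x i = 0

/-- The cone condition: `M + N ∈ U` for all `M ∈ U` and all positive definite `N`. -/
def ConeCondition {n : ℕ} (U : Set (Mat n)) : Prop :=
  ∀ M ∈ U, ∀ N : Mat n, N.PosDef → M + N ∈ U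

/-- Property `P_k`: for every `C > 0` there are `δ, ε₀ > 0` such that `M + ε N ∈ U` for all
`0 < ε < ε₀`, all `M` in the closure of `U` with `M ≤ C I`, and all symmetric `N` with
`λ₁(N) = ⋯ = λ_k(N) = -δ` and `λ_{k+1}(N) = ⋯ = λₙ(N) = 1`. (The closure in the space of all
matrices is the closure in `𝒮ⁿˣⁿ`, as the latter is a closed set.) -/
def PropertyP {n : ℕ} (k : ℕ) (U : Set (Mat n)) : Prop :=
  ∀ C : ℝ, 0 < C → ∃ δ : ℝ, 0 < δ ∧ ∃ ε₀ : ℝ, 0 < ε₀ ∧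
    ∀ ε : ℝ, 0 < ε → ε < ε₀ →
      ∀ N ∈ symMat n, ∀ M ∈ closure U, (C • (1 : Mat n) - M).PosSemidef →
        (∀ i : Fin n, i.val < k → lam N i = -δ) →
        (∀ j : Fin n, k ≤ j.val → lam N j = 1) →
          M + ε • N ∈ U

/-- `L` is a locally Lipschitz map `ℝⁿ × ℝ × ℝⁿ → 𝒮ⁿˣⁿ`, i.e. it has symmetric values and
entries in `C^{0,1}_loc`. -/
def IsLocLipSym {n : ℕ} (L : Eucl n × ℝ × Eucl n → Mat n) : Prop :=
  (∀ p, L p ∈ symMat n) ∧ ∀ i j : Fin n, LocallyLipschitz fun p => L p i j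

/-- The operator `Ã^u = -∇²u + L(·, u, ∇u)`. -/
noncomputable def ATilde {n : ℕ} (L : Eucl n × ℝ × Eucl n → Mat n) (u : Eucl n → ℝ)
    (x : Eucl n) : Mat n :=
  -hessMat u x + L (x, u x, gradient u x)

/-- The filter describing `dist(x, E) → 0` with `x ∈ Ω \ E`. -/
noncomputable def nearSet {n : ℕ} (Ω E : Set (Eucl n)) : Filter (Eucl n) :=
  comap (fun x => Metric.infEDist x E) (𝓝 0) ⊓ 𝓟 (Ω \ E)

/-! By compactness of `E` it suffices to bound `u - v` below by a positive constant near each `x₀ ∈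
E` (`exists_pos_add_le_near_point`). Let `y` be a local defining map of `E`, so that `ker Dy(x₀)` is
the `k`-dimensional tangent space. Two barrier arguments are combined.

Linear growth (`exists_linear_growth`). Take `h_p = (K/2)|y|² - (δ/4)|x - x₀|² + ⟨p, y⟩` with `|p| ≤
c`. On `E` it is nonpositive, and for large `K` its Hessian exceeds a matrix `N` with eigenvalue
`-δ` on the tangent space and `1` on its complement. If `u - v - ε h_p` became negative, it would
have a local minimum off `E`. There `Ã^v` exceeds `Ã^u + ε N` by a positive definite matrix, the
Lipschitz error of `L` being absorbed; Property `P_k` and the cone condition then put `Ã^v` in `U`,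
a contradiction (`not_isLocalMin_sub_perturbation`). Hence `u - v ≥ ε h_p` for every such `p`, and
optimizing over `p` gives `u - v ≥ ε (c|y| - a|x - x₀|²)` with `a = δ/4`.

Minimum principle (`IsSmoothClosedSubmanifold.exists_add_le_of_lamSum_nonpos`). Since `c|y|`
dominates any multiple of `|y|²` near `E`, `u` lies above `θ = v + ε (K|y|² - 2a|x - x₀|²)` by at
least `ε a|x - x₀|²`, now with a new `K`, so large that the Hessian of `θ` has positive trace on
every `(k+2)`-dimensional subspace. The eigenvalue condition on `u` says that its Hessian has
nonpositive trace on some such subspace. A `k`-dimensional set is negligible for this comparison: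
the kernel `|x|^(-k)` has nonpositive Hessian trace on all `(k+2)`-dimensional subspaces, while
averages of it over points of `E` can be made arbitrarily large near `E`, because `∫ |s|^(-k) ds`
diverges logarithmically in dimension `k`. So the gap `u - θ > 0` on a small sphere persists up to
`E`, and `θ - v` vanishes at `x₀`. -/

/-! ### Second derivatives -/

section SecondDerivative

variable {F G : Type*} [NormedAddCommGroup F] [NormedSpace ℝ F]
  [NormedAddCommGroup G] [NormedSpace ℝ G]

/-- The second derivative of `f` at `x` as a quadratic map. -/
noncomputable def secondDeriv (f : F → G) (x ξ : F) : G := fderiv ℝ (fderiv ℝ f) x ξ ξ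

theorem ContDiffAt.differentiableAt_fderiv {f : F → G} {x : F} (hf : ContDiffAt ℝ 2 f x) :
    DifferentiableAt ℝ (fderiv ℝ f) x :=
  (hf.fderiv_right (m := 1) (by norm_num)).differentiableAt (by norm_num)

theorem ContDiffAt.eventually_differentiableAt {f : F → G} {x : F} (hf : ContDiffAt ℝ 2 f x) :
    ∀ᶠ y in 𝓝 x, DifferentiableAt ℝ f y :=
  (hf.eventually (by simp)).mono fun _ h => h.differentiableAt (by norm_num)

theorem secondDeriv_add {f g : F → G} {x : F} (hf : ContDiffAt ℝ 2 f x) (hg : ContDiffAt ℝ 2 g x)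
    (ξ : F) : secondDeriv (fun y => f y + g y) x ξ = secondDeriv f x ξ + secondDeriv g x ξ := by
  have h : fderiv ℝ (fun y => f y + g y) =ᶠ[𝓝 x] fun y => fderiv ℝ f y + fderiv ℝ g y := by
    filter_upwards [hf.eventually_differentiableAt, hg.eventually_differentiableAt] with y h1 h2
    exact fderiv_fun_add h1 h2
  simp only [secondDeriv]
  rw [h.fderiv_eq, fderiv_fun_add hf.differentiableAt_fderiv hg.differentiableAt_fderiv]
  simp

theorem secondDeriv_const_smul {f : F → G} {x : F} (hf : ContDiffAt ℝ 2 f x) (c : ℝ) (ξ : F) :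
    secondDeriv (fun y => c • f y) x ξ = c • secondDeriv f x ξ := by
  have h : fderiv ℝ (fun y => c • f y) =ᶠ[𝓝 x] fun y => c • fderiv ℝ f y := by
    filter_upwards [hf.eventually_differentiableAt] with y h1
    exact fderiv_fun_const_smul h1 c
  simp only [secondDeriv]
  rw [h.fderiv_eq, fderiv_fun_const_smul hf.differentiableAt_fderiv]
  simp

theorem secondDeriv_const_mul {f : F → ℝ} {x : F} (hf : ContDiffAt ℝ 2 f x) (c : ℝ) (ξ : F) :
    secondDeriv (fun y => c * f y) x ξ = c * secondDeriv f x ξ :=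
  secondDeriv_const_smul hf c ξ

theorem secondDeriv_sub {f g : F → ℝ} {x : F} (hf : ContDiffAt ℝ 2 f x) (hg : ContDiffAt ℝ 2 g x)
    (ξ : F) : secondDeriv (fun y => f y - g y) x ξ = secondDeriv f x ξ - secondDeriv g x ξ := by
  have h := secondDeriv_add hf (hg.const_smul (-1 : ℝ)) ξ
  rw [secondDeriv_const_smul hg] at h
  simpa [sub_eq_add_neg] using h

theorem secondDeriv_finset_sum {ι : Type*} (s : Finset ι) {f : ι → F → G} {x : F}
    (hf : ∀ i ∈ s, ContDiffAt ℝ 2 (f i) x) (ξ : F) :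
    secondDeriv (fun y => ∑ i ∈ s, f i y) x ξ = ∑ i ∈ s, secondDeriv (f i) x ξ := by
  classical
  induction s using Finset.induction_on with
  | empty => simp [secondDeriv]
  | insert a s ha ih =>
    simp only [Finset.sum_insert ha]
    rw [secondDeriv_add (hf a (by simp)), ih fun i hi => hf i (by simp [hi])]
    exact ContDiffAt.sum fun i hi => hf i (by simp [hi])

theorem ContDiffAt.continuousAt_fderiv_fderiv {f : F → G} {x : F} (hf : ContDiffAt ℝ 2 f x) :
    ContinuousAt (fderiv ℝ (fderiv ℝ f)) x :=
  ((hf.fderiv_right (m := 1) (by norm_num)).fderiv_right (m := 0) (by norm_num)).continuousAt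

theorem ContinuousAt.eventually_norm_sub_lt {X G : Type*} [TopologicalSpace X]
    [SeminormedAddCommGroup G] {g : X → G} {x : X} (h : ContinuousAt g x) {τ : ℝ} (hτ : 0 < τ) : ∀ᶠ z in 𝓝 x, ‖g z - g x‖ < τ := by
  simpa [dist_eq_norm] using Metric.tendsto_nhds.1 h.tendsto τ hτ

theorem abs_secondDeriv_sub_le (f : F → ℝ) (x z ξ : F) :
    |secondDeriv f x ξ - secondDeriv f z ξ|
      ≤ ‖fderiv ℝ (fderiv ℝ f) x - fderiv ℝ (fderiv ℝ f) z‖ * ‖ξ‖ ^ 2 := by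
  have h := (fderiv ℝ (fderiv ℝ f) x - fderiv ℝ (fderiv ℝ f) z).le_opNorm₂ ξ ξ
  simpa [secondDeriv, pow_two, mul_assoc] using h

theorem abs_secondDeriv_le (f : F → ℝ) (x ξ : F) :
    |secondDeriv f x ξ| ≤ ‖fderiv ℝ (fderiv ℝ f) x‖ * ‖ξ‖ ^ 2 := by
  have h := (fderiv ℝ (fderiv ℝ f) x).le_opNorm₂ ξ ξ
  simpa [secondDeriv, pow_two, mul_assoc] using h

/-- The second derivative is locally almost constant, as a quadratic form. -/
theorem ContDiffAt.eventually_abs_secondDeriv_sub_le {f : F → ℝ} {x : F} (hf : ContDiffAt ℝ 2 f x)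
    {τ : ℝ} (hτ : 0 < τ) :
    ∀ᶠ z in 𝓝 x, ∀ ξ, |secondDeriv f z ξ - secondDeriv f x ξ| ≤ τ * ‖ξ‖ ^ 2 := by
  have h := ContinuousAt.eventually_norm_sub_lt (G := F →L[ℝ] F →L[ℝ] ℝ)
    hf.continuousAt_fderiv_fderiv hτ
  filter_upwards [h] with z hz ξ
  exact (abs_secondDeriv_sub_le f z x ξ).trans (by gcongr)

/-- The second order necessary condition at a local minimum. -/
theorem IsLocalMin.secondDeriv_nonneg {f : F → ℝ} {x : F} (hf : ContDiffAt ℝ 2 f x)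
    (h : IsLocalMin f x) (ξ : F) : 0 ≤ secondDeriv f x ξ := by
  by_contra! hneg
  set l : ℝ → F := fun t => x + t • ξ with hl
  have hl0 : l 0 = x := by simp [hl]
  have hlc : Continuous l := by fun_prop
  have hld : ∀ t, HasDerivAt l ξ t := fun t => by
    have h := ((hasDerivAt_id t).smul_const ξ).const_add x
    rwa [one_smul] at h
  have ht : Tendsto l (𝓝 0) (𝓝 x) := by simpa [hl0] using hlc.tendsto 0
  have h1 : ∀ᶠ t in 𝓝 (0 : ℝ), HasDerivAt (f ∘ l) (fderiv ℝ f (l t) ξ) t := by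
    filter_upwards [ht.eventually hf.eventually_differentiableAt] with t h1
    exact h1.hasFDerivAt.comp_hasDerivAt t (hld t)
  have h2 : deriv (f ∘ l) =ᶠ[𝓝 0] fun t => fderiv ℝ f (l t) ξ := h1.mono fun t h => h.deriv
  have h3 : HasDerivAt (fun t => fderiv ℝ f (l t) ξ) (secondDeriv f x ξ) 0 := by
    have h4 : HasFDerivAt (fderiv ℝ f) (fderiv ℝ (fderiv ℝ f) x) (l 0) := by
      rw [hl0]; exact hf.differentiableAt_fderiv.hasFDerivAt
    have h5 := h4.comp_hasDerivAt 0 (hld 0)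
    simpa [secondDeriv] using h5.clm_apply (hasDerivAt_const 0 ξ)
  have h4 : deriv (deriv (f ∘ l)) 0 = secondDeriv f x ξ := by rw [h2.deriv_eq, h3.deriv]
  have hmin : IsLocalMin (f ∘ l) 0 := by
    have := ht.eventually h
    simpa [IsLocalMin, IsMinFilter, hl0] using this
  have hd : deriv (f ∘ l) 0 = 0 := hmin.deriv_eq_zero
  have hc : ContinuousAt (f ∘ l) 0 := h1.self_of_nhds.continuousAt
  -- A negative second derivative would also make `0` a local maximum along the line; the
  -- restriction is then locally constant and its second derivative is zero.
  have hmax := isLocalMax_of_deriv_deriv_neg (h4 ▸ hneg) hd hc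
  have hconst : (f ∘ l) =ᶠ[𝓝 0] fun _ => (f ∘ l) 0 := by
    filter_upwards [hmin, hmax] with t h1 h2 using le_antisymm h2 h1
  have h5 : deriv (f ∘ l) =ᶠ[𝓝 0] fun _ => 0 := by
    simpa using hconst.deriv
  have h6 := h5.deriv_eq
  rw [h4] at h6
  simp at h6
  exact hneg.ne h6

end SecondDerivative

/-! ### Quadratic forms of matrices and their eigenvalues -/

/-- The quadratic form of a matrix. -/
noncomputable def quadForm {n : ℕ} (M : Mat n) (ξ : Eucl n) : ℝ := ξ.ofLp ⬝ᵥ M.mulVec ξ.ofLp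

section Matrices

variable {n : ℕ}

theorem quadForm_add (M N : Mat n) (ξ : Eucl n) :
    quadForm (M + N) ξ = quadForm M ξ + quadForm N ξ := by
  simp [quadForm, Matrix.add_mulVec]

theorem quadForm_neg (M : Mat n) (ξ : Eucl n) : quadForm (-M) ξ = -quadForm M ξ := by
  simp [quadForm, Matrix.neg_mulVec]

theorem quadForm_sub (M N : Mat n) (ξ : Eucl n) :
    quadForm (M - N) ξ = quadForm M ξ - quadForm N ξ := by
  simp [quadForm, Matrix.sub_mulVec]

theorem quadForm_smul (c : ℝ) (M : Mat n) (ξ : Eucl n) :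
    quadForm (c • M) ξ = c * quadForm M ξ := by
  simp [quadForm, Matrix.smul_mulVec]

theorem quadForm_one (ξ : Eucl n) : quadForm (1 : Mat n) ξ = ‖ξ‖ ^ 2 := by
  rw [EuclideanSpace.real_norm_sq_eq]
  simp [quadForm, dotProduct, pow_two]

theorem quadForm_eq_sum (M : Mat n) (ξ : Eucl n) :
    quadForm M ξ = ∑ i, ∑ j, ξ i * ξ j * M i j := by
  simp only [quadForm, dotProduct, Matrix.mulVec, Finset.mul_sum]
  exact Finset.sum_congr rfl fun i _ => Finset.sum_congr rfl fun j _ => by ring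

theorem abs_quadForm_le (M : Mat n) (b : ℝ) (hb : ∀ i j, |M i j| ≤ b) (ξ : Eucl n) :
    |quadForm M ξ| ≤ n ^ 2 * b * ‖ξ‖ ^ 2 := by
  rw [quadForm_eq_sum]
  have h : ∀ i j : Fin n, |ξ i * ξ j * M i j| ≤ b * ‖ξ‖ ^ 2 := fun i j => by
    rw [abs_mul, abs_mul]
    have h1 : |ξ i| ≤ ‖ξ‖ := PiLp.norm_apply_le ξ i
    have h2 : |ξ j| ≤ ‖ξ‖ := PiLp.norm_apply_le ξ j
    calc |ξ i| * |ξ j| * |M i j| ≤ ‖ξ‖ * ‖ξ‖ * b := by gcongr; exact hb i j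
      _ = _ := by ring
  calc _ ≤ ∑ i : Fin n, ∑ j : Fin n, |ξ i * ξ j * M i j| :=
        (Finset.abs_sum_le_sum_abs _ _).trans
          (Finset.sum_le_sum fun i _ => Finset.abs_sum_le_sum_abs _ _)
    _ ≤ ∑ i : Fin n, ∑ j : Fin n, b * ‖ξ‖ ^ 2 :=
        Finset.sum_le_sum fun i _ => Finset.sum_le_sum fun j _ => h i j
    _ = _ := by simp; ring

theorem isHermitian_iff_mem_symMat {M : Mat n} : M.IsHermitian ↔ M ∈ symMat n := by
  simp [Matrix.IsHermitian, Matrix.conjTranspose_eq_transpose_of_trivial, symMat, Matrix.IsSymm]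

theorem posDef_of_quadForm_pos {M : Mat n} (hM : M ∈ symMat n)
    (h : ∀ ξ : Eucl n, ξ ≠ 0 → 0 < quadForm M ξ) : M.PosDef := by
  refine Matrix.PosDef.of_dotProduct_mulVec_pos (isHermitian_iff_mem_symMat.2 hM) fun x hx => ?_
  simpa [quadForm] using h (WithLp.toLp 2 x) (by simpa using hx)

theorem posSemidef_of_quadForm_nonneg {M : Mat n} (hM : M ∈ symMat n)
    (h : ∀ ξ : Eucl n, 0 ≤ quadForm M ξ) : M.PosSemidef := by
  refine Matrix.PosSemidef.of_dotProduct_mulVec_nonneg (isHermitian_iff_mem_symMat.2 hM) fun x => ?_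
  simpa [quadForm] using h (WithLp.toLp 2 x)

theorem hessMat_apply {f : Eucl n → ℝ} {x : Eucl n} (hf : ContDiffAt ℝ 2 f x) (i j : Fin n) :
    hessMat f x i j = fderiv ℝ (fderiv ℝ f) x (EuclideanSpace.single i 1)
      (EuclideanSpace.single j 1) := by
  have h := hf.differentiableAt_fderiv.hasFDerivAt.clm_apply
    (hasFDerivAt_const (EuclideanSpace.single j (1 : ℝ)) x)
  simp [hessMat, h.fderiv]

theorem quadForm_hessMat {f : Eucl n → ℝ} {x : Eucl n} (hf : ContDiffAt ℝ 2 f x) (ξ : Eucl n) :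
    quadForm (hessMat f x) ξ = secondDeriv f x ξ := by
  have hξ : ξ = ∑ i, ξ i • EuclideanSpace.single i (1 : ℝ) := by
    ext j; simp [Pi.single_apply]
  rw [quadForm_eq_sum, secondDeriv]
  conv_rhs => rw [hξ]
  simp only [map_sum, map_smul, _root_.sum_apply, _root_.smul_apply,
    hessMat_apply hf, smul_eq_mul, Finset.mul_sum]
  rw [Finset.sum_comm]
  exact Finset.sum_congr rfl fun i _ => Finset.sum_congr rfl fun j _ => by ring

theorem hessMat_mem_symMat {f : Eucl n → ℝ} {x : Eucl n} (hf : ContDiffAt ℝ 2 f x) :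
    hessMat f x ∈ symMat n := by
  have h : IsSymmSndFDerivAt ℝ f x := hf.isSymmSndFDerivAt (by simp)
  refine Matrix.IsSymm.ext fun i j => ?_
  rw [hessMat_apply hf, hessMat_apply hf, h.eq]

/-- `λ₁ + ⋯ + λ_m` is the trace of the quadratic form on some orthonormal family. -/
theorem exists_orthonormal_sum_quadForm_eq_lamSum {M : Mat n} (hM : M ∈ symMat n) {m : ℕ}
    (hm : m ≤ n) :
    ∃ e : Fin m → Eucl n, Orthonormal ℝ e ∧ ∑ i, quadForm M (e i) = lamSum m M := by
  classical
  have hH : M.IsHermitian := isHermitian_iff_mem_symMat.2 hM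
  -- `eigenvalues` and `eigenvectorBasis` are indexed through an equivalence with the decreasing
  -- list `eigenvalues₀`; `σ` undoes this and reverses the order.
  let σ : Fin n → Fin n := fun i =>
    Fintype.equivOfCardEq (Fintype.card_fin _) (Fin.cast (Fintype.card_fin n).symm i.rev)
  have hσ : Function.Injective σ := fun i j h => by
    simpa [σ] using h
  have hlam : ∀ i, lam M i = hH.eigenvalues (σ i) := fun i => by
    rw [lam, dif_pos hH]; simp [Matrix.IsHermitian.eigenvalues, σ]
  have hq : ∀ i, quadForm M (hH.eigenvectorBasis (σ i)) = lam M i := fun i => by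
    rw [quadForm, hH.mulVec_eigenvectorBasis, hlam, dotProduct_smul]
    have h1 := quadForm_one (hH.eigenvectorBasis (σ i))
    rw [quadForm, Matrix.one_mulVec, (hH.eigenvectorBasis.orthonormal).1] at h1
    rw [h1]; simp
  refine ⟨fun i => hH.eigenvectorBasis (σ (Fin.castLE hm i)),
    hH.eigenvectorBasis.orthonormal.comp _ (hσ.comp (Fin.castLE_injective hm)), ?_⟩
  simp only [hq, lamSum]
  refine Finset.sum_bij (fun i _ => Fin.castLE hm i) ?_ ?_ ?_ ?_
  · intro i _; simp
  · intro i _ j _ h; simpa using h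
  · intro j hj; exact ⟨⟨j, by simpa using hj⟩, by simp, by ext; simp⟩
  · intro i _; rfl

end Matrices

/-! ### Matrices with prescribed spectrum, and linear maps with `k`-dimensional kernel -/

section Spectrum

variable {n : ℕ}

theorem lam_monotone {M : Mat n} (hM : M ∈ symMat n) : Monotone (lam M) := by
  classical
  have hH : M.IsHermitian := isHermitian_iff_mem_symMat.2 hM
  intro i j hij
  rw [lam, lam, dif_pos hH, dif_pos hH]
  apply hH.eigenvalues₀_antitone
  rw [Fin.cast_le_cast]
  exact Fin.rev_le_rev.2 hij

theorem map_lam_eq_roots_charpoly {M : Mat n} (hM : M ∈ symMat n) :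
    Multiset.map (lam M) Finset.univ.val = M.charpoly.roots := by
  classical
  have hH : M.IsHermitian := isHermitian_iff_mem_symMat.2 hM
  rw [hH.roots_charpoly_eq_eigenvalues₀]
  let σ : Fin n ≃ Fin (Fintype.card (Fin n)) :=
    Fin.revPerm.trans (finCongr (Fintype.card_fin n).symm)
  have h1 : lam M = hH.eigenvalues₀ ∘ σ := by
    ext i
    rw [lam, dif_pos hH]; rfl
  have h2 : (Finset.univ : Finset (Fin (Fintype.card (Fin n)))) =
      Finset.univ.map σ.toEmbedding := by simp
  rw [h2, Finset.map_val, Multiset.map_map, h1]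
  rfl

/-- A monotone family is determined by its multiset of values. -/
theorem eq_of_monotone_of_map_univ_eq {f g : Fin n → ℝ} (hf : Monotone f) (hg : Monotone g)
    (h : Multiset.map f Finset.univ.val = Multiset.map g Finset.univ.val) : f = g := by
  rw [Fin.univ_val_map, Fin.univ_val_map, Multiset.coe_eq_coe] at h
  have h1 : List.ofFn f = List.ofFn g :=
    h.eq_of_pairwise' hf.sortedLE_ofFn.pairwise hg.sortedLE_ofFn.pairwise
  exact List.ofFn_injective h1

/-- The symmetric matrix with eigenvalues `d` in the orthonormal basis `b`. -/
noncomputable def matOfBasis (b : OrthonormalBasis (Fin n) ℝ (Eucl n)) (d : Fin n → ℝ) : Mat n :=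
  Matrix.of fun i j => ∑ l, d l * (b l i * b l j)

theorem matOfBasis_mem_symMat (b : OrthonormalBasis (Fin n) ℝ (Eucl n)) (d : Fin n → ℝ) :
    matOfBasis b d ∈ symMat n :=
  Matrix.IsSymm.ext fun i j => by simp only [matOfBasis, Matrix.of_apply, mul_comm]

theorem quadForm_matOfBasis (b : OrthonormalBasis (Fin n) ℝ (Eucl n)) (d : Fin n → ℝ)
    (ξ : Eucl n) : quadForm (matOfBasis b d) ξ = ∑ l, d l * inner ℝ (b l) ξ ^ 2 := by
  have h : ∀ l, inner ℝ (b l) ξ = ∑ i, ξ i * b l i := fun l => by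
    simp [PiLp.inner_apply]
  rw [quadForm_eq_sum]
  simp only [matOfBasis, Matrix.of_apply, Finset.mul_sum, h, pow_two, Finset.sum_mul]
  rw [Finset.sum_comm, Finset.sum_comm_cycle]
  refine Finset.sum_congr rfl fun l _ => ?_
  rw [Finset.sum_comm]
  exact Finset.sum_congr rfl fun i _ => Finset.sum_congr rfl fun j _ => by ring

/-- Conjugation by an orthogonal matrix preserves the characteristic polynomial, hence the multiset
of eigenvalues; monotonicity of `d` then fixes their order. -/
theorem lam_matOfBasis (b : OrthonormalBasis (Fin n) ℝ (Eucl n)) {d : Fin n → ℝ}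
    (hd : Monotone d) : lam (matOfBasis b d) = d := by
  classical
  refine eq_of_monotone_of_map_univ_eq (lam_monotone (matOfBasis_mem_symMat b d)) hd ?_
  rw [map_lam_eq_roots_charpoly (matOfBasis_mem_symMat b d)]
  let B : Mat n := Matrix.of fun i l => b l i
  have h1 : matOfBasis b d = B * (Matrix.diagonal d * B.transpose) := by
    ext i j
    rw [Matrix.mul_apply]
    simp only [matOfBasis, Matrix.of_apply, Matrix.diagonal_mul, Matrix.transpose_apply, B]
    exact Finset.sum_congr rfl fun l _ => by ring
  have h2 : B.transpose * B = 1 := by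
    ext i j
    have h := orthonormal_iff_ite.1 b.orthonormal i j
    rw [Matrix.one_apply, ← h, Matrix.mul_apply, PiLp.inner_apply]
    exact Finset.sum_congr rfl fun l _ => by simp [B, mul_comm]
  rw [h1, Matrix.charpoly_mul_comm, Matrix.mul_assoc, h2, Matrix.mul_one,
    Matrix.charpoly_diagonal, Polynomial.roots_prod]
  · simp
  · simp [Finset.prod_ne_zero_iff, Polynomial.X_sub_C_ne_zero]

/-- A linear map with `k`-dimensional kernel is bounded below transversally to its kernel. -/
theorem exists_orthonormalBasis_bddBelow {k : ℕ} (T : Eucl n →L[ℝ] Eucl n)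
    (hT : Module.finrank ℝ (LinearMap.ker (T : Eucl n →ₗ[ℝ] Eucl n)) = k) :
    ∃ b : OrthonormalBasis (Fin n) ℝ (Eucl n), ∃ c > 0, ∀ ξ,
      c * ∑ i : Fin n with k ≤ i.val, inner ℝ (b i) ξ ^ 2 ≤ ‖T ξ‖ ^ 2 := by
  classical
  set V := LinearMap.ker (T : Eucl n →ₗ[ℝ] Eucl n) with hV
  let s : OrthonormalBasis (Fin k) ℝ V := (stdOrthonormalBasis ℝ V).reindex (finCongr hT)
  let v : Fin n → Eucl n := fun i => if h : i.val < k then (s ⟨i, h⟩ : Eucl n) else 0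
  have hv : Orthonormal ℝ (({i : Fin n | i.val < k}).domRestrict v) := by
    have h1 : Orthonormal ℝ (fun i => (s i : Eucl n)) :=
      s.orthonormal.comp_linearIsometry V.subtypeₗᵢ
    have h2 := h1.comp (fun i : {i : Fin n | i.val < k} => (⟨i.1, i.2⟩ : Fin k))
      (fun i j h => by
        have := Fin.mk.inj_iff.1 h
        exact Subtype.ext (Fin.ext this))
    convert h2 using 1
    ext1 i
    have := i.2
    simp only [mem_ofPred_eq] at this
    simp [v, Set.domRestrict_apply, this]
  obtain ⟨b, hb⟩ := hv.exists_orthonormalBasis_extension_of_card_eq (by simp)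
  have hbk : ∀ j : Fin n, k ≤ j.val → ∀ z ∈ V, inner ℝ (b j) z = 0 := by
    intro j hj z hz
    have h1 : z = ∑ i : Fin k, inner ℝ (s i) (⟨z, hz⟩ : V) • (s i : Eucl n) := by
      have := congrArg (Subtype.val) (s.sum_repr' ⟨z, hz⟩)
      simpa using this.symm
    rw [h1, inner_sum]
    refine Finset.sum_eq_zero fun i _ => ?_
    have hkn : k ≤ n := by
      rw [← hT]; simpa using Submodule.finrank_le V
    have h2 : (s i : Eucl n) = b (Fin.castLE hkn i) := by
      rw [hb _ (by simp)]; simp [v]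
    rw [h2, inner_smul_right, orthonormal_iff_ite.1 b.orthonormal,
      if_neg (fun h => by rw [h] at hj; have := i.2; simp at hj; omega), mul_zero]
  -- `T` is injective on `Vᗮ`, hence bounded below there by finite dimensionality.
  have hker : LinearMap.ker ((T : Eucl n →ₗ[ℝ] Eucl n).domRestrict Vᗮ) = ⊥ := by
    rw [LinearMap.ker_eq_bot']
    rintro ⟨x, hx⟩ h
    have hxV : x ∈ V := by simpa [hV] using h
    have := (Submodule.mem_orthogonal V x).1 hx x hxV
    exact Subtype.ext (inner_self_eq_zero.1 this)
  obtain ⟨K, hK, hanti⟩ := LinearMap.exists_antilipschitzWith _ hker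
  have hlow : ∀ η ∈ Vᗮ, ‖η‖ ≤ K * ‖T η‖ := fun η hη => by
    simpa using hanti.le_mul_dist ⟨η, hη⟩ 0
  refine ⟨b, ((K : ℝ) ^ 2)⁻¹, by positivity, fun ξ => ?_⟩
  set η : Eucl n := ∑ i : Fin n with k ≤ i.val, inner ℝ (b i) ξ • b i with hη
  have hηV : η ∈ Vᗮ := by
    rw [Submodule.mem_orthogonal']
    intro z hz
    rw [hη, sum_inner]
    refine Finset.sum_eq_zero fun i hi => ?_
    rw [inner_smul_left, hbk i (by simpa using hi) z hz, mul_zero]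
  have hTη : T ξ = T η := by
    conv_lhs => rw [← b.sum_repr' ξ, ← Finset.sum_filter_add_sum_filter_not _
      (fun i : Fin n => k ≤ i.val), map_add]
    rw [← hη, add_eq_left, map_sum]
    refine Finset.sum_eq_zero fun i hi => ?_
    have hi' : i.val < k := by simpa using hi
    rw [map_smul, hb i hi']
    have : T (s ⟨i, hi'⟩ : Eucl n) = 0 := (s ⟨i, hi'⟩).2
    simp [v, hi', this]
  have hnorm : ‖η‖ ^ 2 = ∑ i : Fin n with k ≤ i.val, inner ℝ (b i) ξ ^ 2 := by
    rw [← real_inner_self_eq_norm_sq, hη, b.orthonormal.inner_sum]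
    simp [pow_two]
  rw [← hnorm, hTη, inv_mul_le_iff₀ (by positivity), ← mul_pow]
  exact pow_le_pow_left₀ (norm_nonneg _) (hlow η hηV) 2

/-- Let `N` be `-δ` on `ker T` and `1` on its orthogonal complement. Then `N + δ` is `1 + δ` times
the projection onto that complement, where `T` is bounded below. This makes the matrices of Property
`P_k` comparable to the Hessian of a multiple of `|y|²`. -/
theorem exists_symMat_quadForm_le {k : ℕ} (T : Eucl n →L[ℝ] Eucl n)
    (hT : Module.finrank ℝ (LinearMap.ker (T : Eucl n →ₗ[ℝ] Eucl n)) = k) {δ : ℝ} (hδ : 0 < δ) :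
    ∃ K > 0, ∃ N ∈ symMat n, (∀ i : Fin n, i.val < k → lam N i = -δ) ∧
      (∀ j : Fin n, k ≤ j.val → lam N j = 1) ∧
      ∀ ξ, quadForm N ξ + δ * ‖ξ‖ ^ 2 ≤ K * ‖T ξ‖ ^ 2 := by
  obtain ⟨b, c, hc, hb⟩ := exists_orthonormalBasis_bddBelow T hT
  let d : Fin n → ℝ := fun i => if i.val < k then -δ else 1
  have hd : Monotone d := by
    intro i j hij
    have : i.val ≤ j.val := hij
    simp only [d]
    split_ifs <;> first | omega | linarith
  refine ⟨(1 + δ) / c, by positivity, matOfBasis b d, matOfBasis_mem_symMat b d, ?_, ?_, ?_⟩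
  · intro i hi; rw [lam_matOfBasis b hd]; simp [d, hi]
  · intro i hi; rw [lam_matOfBasis b hd]; simp [d, hi]
  · intro ξ
    have h1 : quadForm (matOfBasis b d) ξ + δ * ‖ξ‖ ^ 2
        = (1 + δ) * ∑ i : Fin n with k ≤ i.val, inner ℝ (b i) ξ ^ 2 := by
      rw [quadForm_matOfBasis, ← b.sum_sq_inner_left ξ, Finset.mul_sum, ← Finset.sum_add_distrib,
        Finset.mul_sum, Finset.sum_filter]
      refine Finset.sum_congr rfl fun i _ => ?_
      rw [real_inner_comm]
      by_cases hi : i.val < k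
      · simp [d, hi, not_le.2 hi]
      · simp [d, hi, not_lt.1 hi]; ring
    rw [h1, div_mul_eq_mul_div, le_div_iff₀ hc, mul_assoc]
    have := hb ξ
    gcongr
    linarith

/-- Orthonormal families with more than `dim ker T` members are seen by `T`. -/
theorem exists_pos_le_sum_norm_sq {k m : ℕ} (hkm : k < m) (T : Eucl n →L[ℝ] Eucl n)
    (hT : Module.finrank ℝ (LinearMap.ker (T : Eucl n →ₗ[ℝ] Eucl n)) = k) :
    ∃ c > 0, ∀ e : Fin m → Eucl n, Orthonormal ℝ e → c ≤ ∑ i, ‖T (e i)‖ ^ 2 := by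
  obtain ⟨b, c, hc, hb⟩ := exists_orthonormalBasis_bddBelow T hT
  have hkn : k ≤ n := by
    rw [← hT]; simpa using Submodule.finrank_le (LinearMap.ker (T : Eucl n →ₗ[ℝ] Eucl n))
  refine ⟨c, hc, fun e he => ?_⟩
  have h1 : ∀ i, ∑ l : Fin n with k ≤ l.val, inner ℝ (b l) (e i) ^ 2
      = 1 - ∑ l : Fin n with ¬ k ≤ l.val, inner ℝ (b l) (e i) ^ 2 := fun i => by
    have := b.sum_sq_inner_left (e i)
    rw [he.1 i, ← Finset.sum_filter_add_sum_filter_not _ (fun i : Fin n => k ≤ i.val)] at this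
    simp only [real_inner_comm] at this ⊢
    linarith
  -- By Bessel, each of the first `k` basis vectors takes away at most `1` from the total mass `m`,
  -- so at least `m - k ≥ 1` is left transversally to the kernel.
  have h2 : ∀ l, ∑ i, inner ℝ (b l) (e i) ^ 2 ≤ 1 := fun l => by
    have := he.sum_inner_products_le (b l) (s := Finset.univ)
    simpa [b.orthonormal.1 l, real_inner_comm] using this
  have h3 : ∑ i, ∑ l : Fin n with ¬ k ≤ l.val, inner ℝ (b l) (e i) ^ 2 ≤ k := by
    rw [Finset.sum_comm]
    refine (Finset.sum_le_sum fun l _ => h2 l).trans ?_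
    have : (Finset.univ.filter fun l : Fin n => ¬ k ≤ l.val).card ≤ k := by
      simp only [not_le]
      rw [Fin.card_filter_val_lt]
      exact min_le_right _ _
    simpa using this
  calc c ≤ c * ∑ i, ∑ l : Fin n with k ≤ l.val, inner ℝ (b l) (e i) ^ 2 := by
        simp only [h1, Finset.sum_sub_distrib]
        have : (k : ℝ) + 1 ≤ m := by exact_mod_cast hkm
        simp only [Finset.sum_const, Finset.card_univ, Fintype.card_fin, nsmul_eq_mul, mul_one]
        nlinarith
    _ ≤ _ := by rw [Finset.mul_sum]; exact Finset.sum_le_sum fun i _ => hb (e i)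

end Spectrum

/-! ### The kernel `|x - z|^(-k)` and interior minima off a closed set -/

section Kernel

variable {n : ℕ}

theorem hasFDerivAt_norm_sub_sq (z x : Eucl n) :
    HasFDerivAt (fun y => ‖y - z‖ ^ 2) (2 • innerSL ℝ (x - z)) x := by
  simpa using ((hasFDerivAt_id x).sub_const z).norm_sq

theorem contDiff_norm_sub_sq (z : Eucl n) : ContDiff ℝ 2 fun y => ‖y - z‖ ^ 2 :=
  (contDiff_id.sub contDiff_const).norm_sq ℝ

theorem hasFDerivAt_two_nsmul_innerSL_sub (z x : Eucl n) :
    HasFDerivAt (fun y => 2 • innerSL ℝ (y - z)) (2 • innerSL ℝ : Eucl n →L[ℝ] Eucl n →L[ℝ] ℝ)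
      x := by
  have h := ((innerSL ℝ : Eucl n →L[ℝ] Eucl n →L[ℝ] ℝ).hasFDerivAt (x := x - z)).comp x
    ((hasFDerivAt_id x).sub_const z)
  exact (h.const_smul (2 : ℕ))

theorem secondDeriv_norm_sub_sq (z x ξ : Eucl n) :
    secondDeriv (fun y => ‖y - z‖ ^ 2) x ξ = 2 * ‖ξ‖ ^ 2 := by
  have h : fderiv ℝ (fun y : Eucl n => ‖y - z‖ ^ 2) = fun y => 2 • innerSL ℝ (y - z) :=
    funext fun y => (hasFDerivAt_norm_sub_sq z y).fderiv
  rw [secondDeriv, h, (hasFDerivAt_two_nsmul_innerSL_sub z x).fderiv]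
  simp only [_root_.smul_apply, nsmul_eq_mul]
  exact congrArg _ (real_inner_self_eq_norm_sq ξ)

/-- The kernel `|x - z|^(2p)`. -/
noncomputable def rieszKernel (p : ℝ) (z x : Eucl n) : ℝ := (‖x - z‖ ^ 2) ^ p

theorem contDiffAt_rieszKernel (p : ℝ) {z x : Eucl n} (h : x ≠ z) :
    ContDiffAt ℝ 2 (rieszKernel p z) x := by
  have h0 : ‖x - z‖ ^ 2 ≠ 0 := by simpa [sub_eq_zero] using h
  exact (contDiff_norm_sub_sq z).contDiffAt.rpow_const_of_ne h0

theorem secondDeriv_rieszKernel (p : ℝ) {z x : Eucl n} (h : x ≠ z) (ξ : Eucl n) :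
    secondDeriv (rieszKernel p z) x ξ =
      4 * p * (p - 1) * (‖x - z‖ ^ 2) ^ (p - 2) * inner ℝ (x - z) ξ ^ 2
        + 2 * p * (‖x - z‖ ^ 2) ^ (p - 1) * ‖ξ‖ ^ 2 := by
  have h0 : ∀ y : Eucl n, y ≠ z → ‖y - z‖ ^ 2 ≠ 0 := fun y hy => by simpa [sub_eq_zero] using hy
  have h1 : fderiv ℝ (rieszKernel p z) =ᶠ[𝓝 x]
      fun y => (p * (‖y - z‖ ^ 2) ^ (p - 1)) • (2 • innerSL ℝ (y - z)) := by
    filter_upwards [isOpen_ne.mem_nhds h] with y hy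
    exact ((hasFDerivAt_norm_sub_sq z y).rpow_const (Or.inl (h0 y hy))).fderiv
  have h2 := ((((hasFDerivAt_norm_sub_sq z x).rpow_const (p := p - 1)
    (Or.inl (h0 x h))).const_mul p).smul (hasFDerivAt_two_nsmul_innerSL_sub z x)).fderiv
  rw [secondDeriv, h1.fderiv_eq]
  erw [h2]
  have hin : ∀ a b : Eucl n, innerSL ℝ a b = inner ℝ a b := fun _ _ => rfl
  simp [hin, inner_sub_left]
  rw [show p - 1 - 1 = p - 2 by ring]
  ring

/-- The sum of the `k + 2` largest eigenvalues of the Hessian of `|x - z|^(-k)` is nonpositive. -/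
theorem sum_secondDeriv_rieszKernel_nonpos (k : ℕ) {z x : Eucl n} (h : x ≠ z)
    {e : Fin (k + 2) → Eucl n} (he : Orthonormal ℝ e) :
    ∑ i, secondDeriv (rieszKernel (-(k : ℝ) / 2) z) x (e i) ≤ 0 := by
  have hs : 0 < ‖x - z‖ ^ 2 := by
    have : 0 < ‖x - z‖ := norm_pos_iff.2 (sub_ne_zero.2 h)
    positivity
  -- For `p = -k/2` the radial coefficient is `k(k+2)`, and the isotropic one is `-k`, counted `k +
  -- 2` times. They balance exactly when Bessel's inequality is an equality.
  have hb : ∑ i, inner ℝ (x - z) (e i) ^ 2 ≤ ‖x - z‖ ^ 2 := by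
    have := he.sum_inner_products_le (x - z) (s := Finset.univ)
    simpa [real_inner_comm] using this
  have hp : (‖x - z‖ ^ 2) ^ (-(k : ℝ) / 2 - 1)
      = (‖x - z‖ ^ 2) ^ (-(k : ℝ) / 2 - 2) * ‖x - z‖ ^ 2 := by
    conv_rhs => rw [← Real.rpow_add_one hs.ne']
    congr 1; ring
  simp only [secondDeriv_rieszKernel _ h, he.1, hp, Finset.sum_add_distrib, ← Finset.mul_sum]
  have hq := Real.rpow_pos_of_pos hs (-(k : ℝ) / 2 - 2)
  set q := (‖x - z‖ ^ 2) ^ (-(k : ℝ) / 2 - 2)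
  simp only [one_pow, mul_one, Finset.sum_const, Finset.card_univ, Fintype.card_fin, nsmul_eq_mul]
  have : (k : ℝ) * (k + 2) * q * ∑ i, inner ℝ (x - z) (e i) ^ 2
      ≤ k * (k + 2) * q * ‖x - z‖ ^ 2 := by gcongr
  push_cast
  nlinarith

theorem rieszKernel_le {k : ℕ} {z x : Eucl n} {d : ℝ} (hd : 0 < d) (h : d ≤ ‖x - z‖) :
    rieszKernel (-(k : ℝ) / 2) z x ≤ (d ^ k)⁻¹ := by
  have h1 : 0 < ‖x - z‖ := hd.trans_le h
  rw [rieszKernel, ← Real.rpow_natCast ‖x - z‖ 2, ← Real.rpow_mul h1.le,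
    show ((2 : ℕ) : ℝ) * (-(k : ℝ) / 2) = -k by push_cast; ring, Real.rpow_neg h1.le,
    Real.rpow_natCast]
  gcongr

theorem le_rieszKernel {k : ℕ} {z x : Eucl n} {d : ℝ} (hx : x ≠ z) (h : ‖x - z‖ ≤ d) :
    (d ^ k)⁻¹ ≤ rieszKernel (-(k : ℝ) / 2) z x := by
  have h1 : 0 < ‖x - z‖ := norm_pos_iff.2 (sub_ne_zero.2 hx)
  rw [rieszKernel, ← Real.rpow_natCast ‖x - z‖ 2, ← Real.rpow_mul h1.le,
    show ((2 : ℕ) : ℝ) * (-(k : ℝ) / 2) = -k by push_cast; ring, Real.rpow_neg h1.le,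
    Real.rpow_natCast]
  gcongr

theorem rieszKernel_nonneg (p : ℝ) (z x : Eucl n) : 0 ≤ rieszKernel p z x := by
  unfold rieszKernel; positivity

/-- A function on a ball minus a closed set `E` that is large near `E` and on the sphere
has an interior local minimum. -/
theorem exists_isLocalMin_of_large {x₀ x₁ : Eucl n} {r : ℝ} {E : Set (Eucl n)} (hE : IsClosed E)
    {f : Eucl n → ℝ} (hf : ContinuousOn f (Metric.closedBall x₀ r \ E))
    (hx₁ : x₁ ∈ Metric.closedBall x₀ r \ E)
    (hfE : ∀ x ∈ E ∩ Metric.closedBall x₀ r, ∀ᶠ y in 𝓝[Eᶜ] x, f x₁ < f y)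
    (hfs : ∀ x ∈ Metric.sphere x₀ r \ E, f x₁ < f x) :
    ∃ x ∈ Metric.ball x₀ r \ E, IsLocalMin f x ∧ f x ≤ f x₁ := by
  set B := Metric.closedBall x₀ r
  -- The punctured ball is not compact, but this sublevel set is: `hfE` keeps its limit points away
  -- from `E`.
  let Q : Set (Eucl n) := {x ∈ B \ E | f x ≤ f x₁}
  have hQc : IsCompact Q := by
    refine (isCompact_closedBall x₀ r).of_isClosed_subset ?_ fun x hx => hx.1.1
    refine isClosed_of_closure_subset fun x hx => ?_
    have hxB : x ∈ B := Metric.isClosed_closedBall.closure_subset_iff.2 (fun y hy => hy.1.1) hx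
    have hfr := mem_closure_iff_frequently.1 hx
    by_cases hxE : x ∈ E
    · exfalso
      have h1 := eventually_nhdsWithin_iff.1 (hfE x ⟨hxE, hxB⟩)
      obtain ⟨y, hy, h2⟩ := (hfr.and_eventually h1).exists
      exact absurd (h2 hy.1.2) (not_lt.2 hy.2)
    · refine ⟨⟨hxB, hxE⟩, ?_⟩
      by_contra! hlt
      have h1 := (hf x ⟨hxB, hxE⟩).eventually_const_lt hlt
      obtain ⟨y, hy, h2⟩ := (hfr.and_eventually (eventually_nhdsWithin_iff.1 h1)).exists
      exact absurd (h2 hy.1) (not_lt.2 hy.2)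
  obtain ⟨x, hx, hmin⟩ := hQc.exists_isMinOn ⟨x₁, hx₁, le_rfl⟩ (hf.mono fun y hy => hy.1)
  have hxs : x ∈ Metric.ball x₀ r := by
    rcases (Metric.mem_closedBall.1 hx.1.1).lt_or_eq with h | h
    · exact h
    · exact absurd (hfs x ⟨h, hx.1.2⟩) (not_lt.2 hx.2)
  refine ⟨x, ⟨hxs, hx.1.2⟩, ?_, hx.2⟩
  filter_upwards [Metric.isOpen_ball.mem_nhds hxs, hE.isOpen_compl.mem_nhds hx.1.2] with y hy hyE
  by_cases hyQ : f y ≤ f x₁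
  · exact hmin ⟨⟨Metric.ball_subset_closedBall hy, hyE⟩, hyQ⟩
  · exact hx.2.trans (not_le.1 hyQ).le

end Kernel

/-! ### Divergence of the `|x|^(-k)` potential on a `k`-dimensional set -/

section Capacity

/-- The harmonic-type lower bound of `∑ |t|^(-k)` over a grid in dimension `k`. -/
theorem harmonic_le_sum_grid {k : ℕ} {m : ℕ} (S : Finset (Fin (k + 1) → ℤ))
    (t₀ : Fin (k + 1) → ℤ)
    (hS : ∀ j : Fin (k + 1) → ℕ, (∀ i, j i < m) → (fun i => t₀ i + j i) ∈ S)
    (f : (Fin (k + 1) → ℤ) → ℝ) (hf0 : ∀ t, 0 ≤ f t) {a : ℝ}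
    (hf : ∀ (j : Fin (k + 1) → ℕ) (l : ℕ), (∀ i, j i < m) → (∀ i, j i ≤ l) →
      a * (((l : ℝ) + 1) ^ (k + 1))⁻¹ ≤ f fun i => t₀ i + j i) :
    a * ∑ l ∈ Finset.range m, 1 / ((l : ℝ) + 1) ≤ ∑ t ∈ S, f t := by
  classical
  -- Only offsets whose first coordinate `l` is the largest are kept. Layer `l` has `(l+1)^k`
  -- members, each contributing at least `a (l+1)^(-(k+1))`, which gives the harmonic series.
  let P : Finset (Σ _ : ℕ, Fin k → ℕ) :=
    (Finset.range m).sigma fun l => Fintype.piFinset fun _ => Finset.range (l + 1)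
  let J : (Σ _ : ℕ, Fin k → ℕ) → Fin (k + 1) → ℕ := fun q => Fin.cons q.1 q.2
  have hJl : ∀ q ∈ P, ∀ i, J q i ≤ q.1 := by
    intro q hq i
    have hq2 := (Finset.mem_sigma.1 hq).2
    refine Fin.cases (by simp [J]) (fun i => ?_) i
    have := Fintype.mem_piFinset.1 hq2 i
    simp only [J, Fin.cons_succ]
    exact Nat.lt_succ_iff.1 (Finset.mem_range.1 this)
  have hJm : ∀ q ∈ P, ∀ i, J q i < m := fun q hq i =>
    (hJl q hq i).trans_lt (Finset.mem_range.1 (Finset.mem_sigma.1 hq).1)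
  let g : (Σ _ : ℕ, Fin k → ℕ) → Fin (k + 1) → ℤ := fun q i => t₀ i + J q i
  have hg : Set.InjOn g P := by
    rintro ⟨l, s⟩ - ⟨l', s'⟩ - h
    have h1 : J ⟨l, s⟩ = J ⟨l', s'⟩ := funext fun i => by
      have := congrFun h i
      simpa [g] using this
    obtain ⟨h2, h3⟩ := Fin.cons_inj.1 h1
    simp only at h2 h3
    rw [h2, h3]
  have hsub : P.image g ⊆ S := by
    intro t ht
    obtain ⟨q, hq, rfl⟩ := Finset.mem_image.1 ht
    exact hS (J q) (hJm q hq)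
  calc a * ∑ l ∈ Finset.range m, 1 / ((l : ℝ) + 1)
      = ∑ q ∈ P, a * (((q.1 : ℝ) + 1) ^ (k + 1))⁻¹ := by
        rw [Finset.sum_sigma, Finset.mul_sum]
        refine Finset.sum_congr rfl fun l _ => ?_
        dsimp only
        rw [Finset.sum_const, Fintype.card_piFinset_const, Finset.card_range, nsmul_eq_mul]
        have : (l : ℝ) + 1 ≠ 0 := by positivity
        push_cast
        field_simp
        ring
    _ ≤ ∑ q ∈ P, f (g q) := Finset.sum_le_sum fun q hq => hf (J q) q.1 (hJm q hq) (hJl q hq)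
    _ = ∑ t ∈ P.image g, f t := (Finset.sum_image hg).symm
    _ ≤ ∑ t ∈ S, f t := Finset.sum_le_sum_of_subset_of_nonneg hsub fun t _ _ => hf0 t

/-- A Lipschitz image of a `k`-dimensional cube carries finite probability measures whose
potential with respect to the kernel `|x|^(-k)` is as large as we want. -/
theorem exists_grid_potential_large {n k : ℕ} (hk : 1 ≤ k) {E : Set (Eucl n)}
    {g : (Fin k → ℝ) → Eucl n} {s₀ : Fin k → ℝ} {R Λ : ℝ} (hR : 0 < R) (hΛ : 0 < Λ)
    (hgE : ∀ s ∈ Metric.closedBall s₀ R, g s ∈ E)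
    (hg : ∀ s ∈ Metric.closedBall s₀ R, ∀ s' ∈ Metric.closedBall s₀ R,
      ‖g s - g s'‖ ≤ Λ * ‖s - s'‖) (A : ℝ) :
    ∃ (S : Finset (Fin k → ℤ)) (Z : (Fin k → ℤ) → Eucl n), S.Nonempty ∧ (∀ t ∈ S, Z t ∈ E) ∧
      ∀ s ∈ Metric.closedBall s₀ (R / 2), ∀ᶠ y in 𝓝[Eᶜ] (g s),
        A < (S.card : ℝ)⁻¹ * ∑ t ∈ S, rieszKernel (-(k : ℝ) / 2) (Z t) y := by
  classical
  obtain ⟨k, rfl⟩ : ∃ k', k = k' + 1 := ⟨k - 1, by omega⟩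
  -- The target `A` is multiplied by `(5ΛR)^(k+1)`, which bounds the number of grid points times the
  -- scale factor `(2Λh)^(k+1)` of the kernel, whatever `m` is (`hc5`).
  obtain ⟨m, hm, hmpos⟩ : ∃ m : ℕ, A * (5 * Λ * R) ^ (k + 1)
      < ∑ l ∈ Finset.range m, 1 / ((l : ℝ) + 1) ∧ 0 < m :=
    ((Real.tendsto_sum_range_one_div_nat_succ_atTop.eventually_gt_atTop _).and
      (eventually_gt_atTop 0)).exists
  have hm0 : (0 : ℝ) < m := by exact_mod_cast hmpos
  set h : ℝ := R / (2 * m) with hh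
  have hhpos : 0 < h := by positivity
  have hmh : m * h = R / 2 := by rw [hh]; field_simp
  -- The grid reaches `2m` steps: at most `m` to arrive at the cell of `s`, and fewer than `m`
  -- further for the offsets.
  let S : Finset (Fin (k + 1) → ℤ) :=
    Fintype.piFinset fun _ => Finset.Icc (-(2 * m : ℤ)) (2 * m)
  let pt : (Fin (k + 1) → ℤ) → Fin (k + 1) → ℝ := fun t i => s₀ i + h * t i
  have hpt : ∀ t ∈ S, pt t ∈ Metric.closedBall s₀ R := by
    intro t ht
    rw [Metric.mem_closedBall, dist_pi_le_iff hR.le]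
    intro i
    have h1 := Finset.mem_Icc.1 (Fintype.mem_piFinset.1 ht i)
    have h2 : (-(2 * m) : ℝ) ≤ t i := by exact_mod_cast h1.1
    have h3 : (t i : ℝ) ≤ 2 * m := by exact_mod_cast h1.2
    rw [Real.dist_eq, abs_le]
    simp only [pt, add_sub_cancel_left]
    constructor <;> nlinarith
  have hSne : S.Nonempty := ⟨fun _ => 0, by simp [S]⟩
  have hcard : (S.card : ℝ) = (4 * m + 1) ^ (k + 1) := by
    rw [Fintype.card_piFinset_const, Int.card_Icc]
    have : ((2 * m + 1 - -(2 * m) : ℤ)).toNat = 4 * m + 1 := by omega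
    rw [this]; push_cast; simp
  refine ⟨S, fun t => g (pt t), hSne, fun t ht => hgE _ (hpt t ht), fun s hs => ?_⟩
  have hsR : s ∈ Metric.closedBall s₀ R :=
    Metric.closedBall_subset_closedBall (by linarith) hs
  have hs' : ∀ i, |s i - s₀ i| ≤ m * h := fun i => by
    rw [hmh]
    simpa [Real.dist_eq] using (dist_pi_le_iff (by positivity)).1 hs i
  let t₀ : Fin (k + 1) → ℤ := fun i => ⌊(s i - s₀ i) / h⌋
  have ht₀1 : ∀ i, h * t₀ i ≤ s i - s₀ i := fun i => by
    have := Int.floor_le ((s i - s₀ i) / h)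
    rw [le_div_iff₀ hhpos] at this
    rw [mul_comm]; exact this
  have ht₀2 : ∀ i, s i - s₀ i ≤ h * t₀ i + h := fun i => by
    have := (Int.lt_floor_add_one ((s i - s₀ i) / h)).le
    rw [div_le_iff₀ hhpos] at this
    simp only [t₀]; linarith
  have ht₀3 : ∀ i, -(m : ℤ) ≤ t₀ i ∧ t₀ i ≤ m := fun i => by
    have h1 := abs_le.1 (hs' i)
    constructor
    · refine Int.le_floor.2 ?_
      rw [le_div_iff₀ hhpos]; push_cast; linarith
    · have : (t₀ i : ℝ) ≤ m := by
        have h2 := ht₀1 i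
        by_contra! hc
        nlinarith
      exact_mod_cast this
  have hgrid : ∀ j : Fin (k + 1) → ℕ, (∀ i, j i < m) → (fun i => t₀ i + j i) ∈ S := by
    intro j hj
    refine Fintype.mem_piFinset.2 fun i => Finset.mem_Icc.2 ?_
    have h1 := ht₀3 i
    have h2 : (j i : ℤ) < m := by exact_mod_cast hj i
    constructor <;> omega
  have hdist : ∀ (j : Fin (k + 1) → ℕ) (l : ℕ), (∀ i, j i < m) → (∀ i, j i ≤ l) →
      ‖g s - g (pt fun i => t₀ i + j i)‖ ≤ Λ * (h * (l + 1)) := by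
    intro j l hj hl
    refine (hg s hsR _ (hpt _ (hgrid j hj))).trans ?_
    gcongr
    rw [pi_norm_le_iff_of_nonneg (by positivity)]
    intro i
    have h1 := ht₀1 i
    have h2 := ht₀2 i
    have h3 : (j i : ℝ) ≤ l := by exact_mod_cast hl i
    have h4 : (0 : ℝ) ≤ j i := by positivity
    have h5 : h * j i ≤ h * l := by gcongr
    have h6 : 0 ≤ h * j i := by positivity
    rw [Real.norm_eq_abs, abs_le]
    simp only [Pi.sub_apply, pt]
    push_cast
    constructor <;> nlinarith
  have hev : ∀ᶠ y in 𝓝[Eᶜ] (g s), ‖y - g s‖ < Λ * h := by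
    refine nhdsWithin_le_nhds ?_
    have : 0 < Λ * h := by positivity
    filter_upwards [Metric.ball_mem_nhds (g s) this] with y hy
    simpa [dist_eq_norm] using hy
  filter_upwards [hev, self_mem_nhdsWithin] with y hy hyE
  have hlow := harmonic_le_sum_grid S t₀ hgrid
    (fun t => rieszKernel (-((k + 1 : ℕ) : ℝ) / 2) (g (pt t)) y)
    (fun t => rieszKernel_nonneg _ _ _) (a := ((2 * Λ * h) ^ (k + 1))⁻¹) (by
      intro j l hj hl
      have hne : y ≠ g (pt fun i => t₀ i + j i) := fun he =>
        hyE (he ▸ hgE _ (hpt _ (hgrid j hj)))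
      -- The distance from `y` to `g s` costs one more `Λh`, and `l + 2 ≤ 2(l + 1)`.
      have h1 : ‖y - g (pt fun i => t₀ i + j i)‖ ≤ 2 * Λ * h * (l + 1) := by
        have h2 := norm_sub_le_norm_sub_add_norm_sub y (g s) (g (pt fun i => t₀ i + j i))
        have h3 := hdist j l hj hl
        have h4 : 0 ≤ Λ * h * l := by positivity
        nlinarith
      have h2 := le_rieszKernel (k := k + 1) hne h1
      rwa [mul_pow, mul_inv] at h2)
  have hc5 : (4 * m + 1) * (2 * Λ * h) ≤ 5 * Λ * R := by
    have h1 : (1 : ℝ) ≤ m := by exact_mod_cast hmpos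
    have h2 : (4 * m + 1) * h ≤ 5 * (m * h) := by nlinarith
    rw [hmh] at h2
    nlinarith
  rw [inv_mul_eq_div, lt_div_iff₀ (by rw [hcard]; positivity), hcard]
  refine lt_of_lt_of_le ?_ hlow
  rw [inv_mul_eq_div, lt_div_iff₀ (by positivity), mul_assoc, ← mul_pow]
  rcases le_or_gt A 0 with hA | hA
  · have hH : 0 < ∑ l ∈ Finset.range m, 1 / ((l : ℝ) + 1) :=
      Finset.sum_pos (fun l _ => by positivity) ⟨0, by simpa using hmpos⟩
    have : 0 ≤ ((4 * m + 1) * (2 * Λ * h)) ^ (k + 1) := by positivity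
    nlinarith
  · refine lt_of_le_of_lt ?_ hm
    gcongr

end Capacity

/-! ### Defining maps and Lipschitz parametrizations of the submanifold -/

section Chart

variable {n : ℕ}

/-- The projection of `ℝⁿ` that kills the first `k` coordinates. -/
noncomputable def coordProj (n k : ℕ) : Eucl n →L[ℝ] Eucl n :=
  LinearMap.toContinuousLinearMap
    { toFun := fun x => WithLp.toLp 2 fun i => if k ≤ i.val then x i else 0
      map_add' := fun x y => by ext i; by_cases h : k ≤ i.val <;> simp [h]
      map_smul' := fun c x => by ext i; by_cases h : k ≤ i.val <;> simp [h] }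

theorem coordProj_apply (n k : ℕ) (x : Eucl n) (i : Fin n) :
    coordProj n k x i = if k ≤ i.val then x i else 0 := rfl

theorem coordProj_eq_zero_iff {k : ℕ} {x : Eucl n} :
    coordProj n k x = 0 ↔ ∀ i : Fin n, k ≤ i.val → x i = 0 := by
  constructor
  · intro h i hi
    have := congrArg (fun z : Eucl n => z i) h
    simpa [coordProj_apply, hi] using this
  · intro h
    ext i
    by_cases hi : k ≤ i.val
    · simp [coordProj_apply, hi, h i hi]
    · simp [coordProj_apply, hi]

/-- The inclusion of `ℝᵏ` as the first `k` coordinates of `ℝⁿ`. -/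
noncomputable def coordEmb (n k : ℕ) : (Fin k → ℝ) →L[ℝ] Eucl n :=
  LinearMap.toContinuousLinearMap
    { toFun := fun s => WithLp.toLp 2 fun i => if h : i.val < k then s ⟨i, h⟩ else 0
      map_add' := fun x y => by ext i; by_cases h : i.val < k <;> simp [h]
      map_smul' := fun c x => by ext i; by_cases h : i.val < k <;> simp [h] }

theorem coordEmb_apply (n k : ℕ) (s : Fin k → ℝ) (i : Fin n) :
    coordEmb n k s i = if h : i.val < k then s ⟨i, h⟩ else 0 := rfl

theorem coordEmb_restrict {k : ℕ} (hk : k ≤ n) {x : Eucl n}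
    (hx : ∀ i : Fin n, k ≤ i.val → x i = 0) :
    coordEmb n k (fun i => x (Fin.castLE hk i)) = x := by
  ext i
  rw [coordEmb_apply]
  split_ifs with h
  · rfl
  · exact (hx i (not_lt.1 h)).symm

theorem coordEmb_apply_of_le {k : ℕ} (s : Fin k → ℝ) {i : Fin n} (hi : k ≤ i.val) :
    coordEmb n k s i = 0 := by
  rw [coordEmb_apply, dif_neg (not_lt.2 hi)]

theorem finrank_ker_coordProj {k : ℕ} (hk : k ≤ n) :
    Module.finrank ℝ (LinearMap.ker (coordProj n k : Eucl n →ₗ[ℝ] Eucl n)) = k := by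
  have h1 : LinearMap.range (coordEmb n k : (Fin k → ℝ) →ₗ[ℝ] Eucl n)
      = LinearMap.ker (coordProj n k : Eucl n →ₗ[ℝ] Eucl n) := by
    ext x
    simp only [LinearMap.mem_range, LinearMap.mem_ker, ContinuousLinearMap.coe_coe,
      coordProj_eq_zero_iff]
    constructor
    · rintro ⟨s, rfl⟩ i hi
      exact coordEmb_apply_of_le s hi
    · intro h
      exact ⟨_, coordEmb_restrict hk h⟩
  have h2 : Function.Injective (coordEmb n k : (Fin k → ℝ) →ₗ[ℝ] Eucl n) := by
    intro s s' h
    ext i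
    have := congrArg (fun z : Eucl n => z (Fin.castLE hk i)) h
    simpa [coordEmb_apply] using this
  rw [← h1, LinearMap.finrank_range_of_inj h2]
  simp

theorem finrank_ker_comp_of_injective (P D : Eucl n →L[ℝ] Eucl n) (hD : Function.Injective D) :
    Module.finrank ℝ (LinearMap.ker ((P.comp D : Eucl n →L[ℝ] Eucl n) : Eucl n →ₗ[ℝ] Eucl n))
      = Module.finrank ℝ (LinearMap.ker (P : Eucl n →ₗ[ℝ] Eucl n)) := by
  let e : Eucl n ≃ₗ[ℝ] Eucl n := LinearEquiv.ofInjectiveEndo (D : Eucl n →ₗ[ℝ] Eucl n) hD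
  have h : LinearMap.ker ((P.comp D : Eucl n →L[ℝ] Eucl n) : Eucl n →ₗ[ℝ] Eucl n)
      = (LinearMap.ker (P : Eucl n →ₗ[ℝ] Eucl n)).map (e.symm : Eucl n →ₗ[ℝ] Eucl n) := by
    rw [← Submodule.comap_equiv_eq_map_symm]
    rfl
  rw [h, LinearEquiv.finrank_map_eq]

/-- Near each of its points, a submanifold is the regular zero set of a smooth map. -/
theorem IsSmoothClosedSubmanifold.exists_defining_map {k : ℕ} (hk : k ≤ n) {E : Set (Eucl n)}
    (hE : IsSmoothClosedSubmanifold k E) {x₀ : Eucl n} (hx₀ : x₀ ∈ E) :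
    ∃ (O : Set (Eucl n)) (y : Eucl n → Eucl n), IsOpen O ∧ x₀ ∈ O ∧ ContDiffOn ℝ 2 y O ∧
      (∀ x ∈ O, x ∈ E ↔ y x = 0) ∧
      Module.finrank ℝ (LinearMap.ker (fderiv ℝ y x₀ : Eucl n →ₗ[ℝ] Eucl n)) = k := by
  obtain ⟨φ, hpφ, hφ, hφs, hφE⟩ := hE.exists_slice x₀ hx₀
  refine ⟨φ.source, fun x => coordProj n k (φ x), φ.open_source, hpφ,
    ((coordProj n k).contDiff.comp_contDiffOn hφ).of_le (by norm_cast), fun x hx => ?_,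
    ?_⟩
  · rw [hφE x hx, coordProj_eq_zero_iff]
  · have h1 : DifferentiableAt ℝ φ x₀ :=
      (hφ.contDiffAt (φ.open_source.mem_nhds hpφ)).differentiableAt (by simp)
    have h2 : DifferentiableAt ℝ φ.symm (φ x₀) :=
      (hφs.contDiffAt (φ.open_target.mem_nhds (φ.map_source hpφ))).differentiableAt (by simp)
    have h3 := h2.hasFDerivAt.comp x₀ h1.hasFDerivAt
    have h4 : (φ.symm ∘ φ) =ᶠ[𝓝 x₀] id := φ.eventually_left_inverse hpφ
    have h5 := (h3.congr_of_eventuallyEq h4.symm).unique (hasFDerivAt_id x₀)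
    have hinj : Function.Injective (fderiv ℝ φ x₀) := by
      refine Function.LeftInverse.injective (g := fderiv ℝ φ.symm (φ x₀)) fun ξ => ?_
      have := DFunLike.congr_fun h5 ξ
      simpa using this
    have h6 : fderiv ℝ (fun x => coordProj n k (φ x)) x₀ = (coordProj n k).comp (fderiv ℝ φ x₀) :=
      ((coordProj n k).hasFDerivAt.comp x₀ h1.hasFDerivAt).fderiv
    rw [h6, finrank_ker_comp_of_injective _ _ hinj, finrank_ker_coordProj hk]

/-- Near each of its points, a `k`-dimensional submanifold is a Lipschitz image of a cube. -/
theorem IsSmoothClosedSubmanifold.exists_lipschitz_parametrization {k : ℕ} (hk : k ≤ n)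
    {E : Set (Eucl n)} (hE : IsSmoothClosedSubmanifold k E) {x₀ : Eucl n} (hx₀ : x₀ ∈ E) :
    ∃ (g : (Fin k → ℝ) → Eucl n) (s₀ : Fin k → ℝ) (R Λ r : ℝ), 0 < R ∧ 0 < Λ ∧ 0 < r ∧
      (∀ s ∈ Metric.closedBall s₀ R, g s ∈ E) ∧
      (∀ s ∈ Metric.closedBall s₀ R, ∀ s' ∈ Metric.closedBall s₀ R,
        ‖g s - g s'‖ ≤ Λ * ‖s - s'‖) ∧
      ∀ x ∈ E ∩ Metric.closedBall x₀ r, ∃ s ∈ Metric.closedBall s₀ (R / 2), g s = x := by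
  obtain ⟨φ, hpφ, hφ, hφs, hφE⟩ := hE.exists_slice x₀ hx₀
  let ρ : Eucl n → Fin k → ℝ := fun x i => φ x (Fin.castLE hk i)
  have hρ : ∀ x ∈ φ.source, x ∈ E → coordEmb n k (ρ x) = φ x := fun x hx hxE =>
    coordEmb_restrict hk ((hφE x hx).1 hxE)
  set s₀ := ρ x₀ with hs₀
  have hes₀ : coordEmb n k s₀ = φ x₀ := hρ x₀ hpφ hx₀
  have htar : φ.target ∈ 𝓝 (coordEmb n k s₀) := by
    rw [hes₀]; exact φ.open_target.mem_nhds (φ.map_source hpφ)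
  have hg : ContDiffAt ℝ 1 (fun s => φ.symm (coordEmb n k s)) s₀ :=
    ((hφs.contDiffAt htar).of_le (by norm_cast)).comp s₀
      (coordEmb n k).contDiff.contDiffAt
  obtain ⟨K, t, ht, hK⟩ := hg.exists_lipschitzOnWith
  have ht' := (coordEmb n k).continuous.continuousAt.preimage_mem_nhds htar
  obtain ⟨R, hR, hRt⟩ := Metric.nhds_basis_closedBall.mem_iff.1 (Filter.inter_mem ht ht')
  have hρc : ContinuousAt ρ x₀ := by
    refine continuousAt_pi.2 fun i => ?_
    have h1 : ContinuousAt φ x₀ := φ.continuousAt hpφ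
    exact (EuclideanSpace.proj (𝕜 := ℝ) (Fin.castLE hk i)).continuous.continuousAt.comp h1
  -- Parameters are confined to half the radius, leaving room in the cube for a grid around each of
  -- them.
  have h1 := hρc.preimage_mem_nhds (Metric.closedBall_mem_nhds s₀ (half_pos hR))
  obtain ⟨r, hr, hrt⟩ := Metric.nhds_basis_closedBall.mem_iff.1
    (Filter.inter_mem h1 (φ.open_source.mem_nhds hpφ))
  refine ⟨fun s => φ.symm (coordEmb n k s), s₀, R, K + 1, r, hR, by positivity, hr, ?_, ?_, ?_⟩
  · intro s hs
    have hst : coordEmb n k s ∈ φ.target := (hRt hs).2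
    rw [hφE _ (φ.map_target hst), φ.right_inv hst]
    exact fun i hi => coordEmb_apply_of_le s hi
  · intro s hs s' hs'
    have h2 := hK.dist_le_mul s (hRt hs).1 s' (hRt hs').1
    rw [dist_eq_norm, dist_eq_norm] at h2
    refine h2.trans ?_
    gcongr
    linarith
  · intro x hx
    have hx2 := hrt hx.2
    refine ⟨ρ x, hx2.1, ?_⟩
    dsimp only
    rw [hρ x hx2.2 hx.1, φ.left_inv hx2.2]

end Chart

/-! ### Minimum principle across a `k`-dimensional set -/

section MinimumPrinciple

variable {n : ℕ}

theorem sum_le_sum_of_abs_sub_le {ι F : Type*} [Fintype ι] [NormedAddCommGroup F]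
    [InnerProductSpace ℝ F] {q q' : F → ℝ} {τ : ℝ}
    (h : ∀ ξ, |q ξ - q' ξ| ≤ τ * ‖ξ‖ ^ 2) {e : ι → F} (he : Orthonormal ℝ e) :
    ∑ i, q' (e i) - Fintype.card ι * τ ≤ ∑ i, q (e i) := by
  have h1 : ∀ i, q' (e i) - τ ≤ q (e i) := fun i => by
    have := (abs_le.1 (h (e i))).1
    rw [he.1 i] at this
    linarith
  have h2 := Finset.sum_le_sum fun i (_ : i ∈ Finset.univ) => h1 i
  simpa [Finset.sum_sub_distrib] using h2

/-- A function whose `k + 2` lowest Hessian eigenvalues have nonpositive sum off a `k`-dimensional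
submanifold cannot approach, on the submanifold, a strictly `(k + 2)`-subharmonic function that
touches it from below at an isolated point. -/
theorem IsSmoothClosedSubmanifold.exists_add_le_of_lamSum_nonpos {k : ℕ} (hk : 1 ≤ k)
    (hkn : k + 2 ≤ n) {E O : Set (Eucl n)} (hE : IsSmoothClosedSubmanifold k E) {x₀ : Eucl n}
    (hx₀ : x₀ ∈ E) (hO : IsOpen O) (hx₀O : x₀ ∈ O) {u θ : Eucl n → ℝ}
    (hu : ContDiffOn ℝ 2 u (O \ E)) (hθ : ContDiffOn ℝ 2 θ O)
    (hlam : ∀ x ∈ O \ E, lamSum (k + 2) (hessMat u x) ≤ 0) {τ : ℝ} (hτ : 0 < τ)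
    (hθ₀ : ∀ e : Fin (k + 2) → Eucl n, Orthonormal ℝ e → τ ≤ ∑ i, secondDeriv θ x₀ (e i))
    {a r : ℝ} (ha : 0 < a) (hr : 0 < r)
    (hle : ∀ x ∈ Metric.ball x₀ r \ E, θ x + a * ‖x - x₀‖ ^ 2 ≤ u x) :
    ∃ m > 0, ∃ s > 0, ∀ x ∈ Metric.ball x₀ s \ E, θ x + m ≤ u x := by
  have hEc : IsClosed E := hE.isCompact.isClosed
  have hOE : IsOpen (O \ E) := hO.sdiff hEc
  obtain ⟨g, s₀, R, Λ, r₁, hR, hΛ, hr₁, hgE, hg, hgx⟩ :=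
    hE.exists_lipschitz_parametrization (by omega) hx₀
  have hθx₀ : ContDiffAt ℝ 2 θ x₀ := hθ.contDiffAt (hO.mem_nhds hx₀O)
  have hk2 : (0 : ℝ) < k + 2 := by positivity
  -- With this tolerance the trace over `k + 2` unit vectors loses at most `τ / 2`.
  have hτ' : 0 < τ / (2 * (k + 2)) := by positivity
  obtain ⟨r₂, hr₂, hr₂s⟩ := Metric.nhds_basis_closedBall.mem_iff.1
    (Filter.inter_mem (hO.mem_nhds hx₀O) (hθx₀.eventually_abs_secondDeriv_sub_le hτ'))
  set s := min (r / 2) (min r₁ r₂) with hs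
  have hspos : 0 < s := by positivity
  have hsr : s < r := (min_le_left _ _).trans_lt (by linarith)
  have hsr₁ : s ≤ r₁ := (min_le_right _ _).trans (min_le_left _ _)
  have hsr₂ : s ≤ r₂ := (min_le_right _ _).trans (min_le_right _ _)
  have hsO : ∀ x ∈ Metric.closedBall x₀ s, x ∈ O := fun x hx =>
    (hr₂s (Metric.closedBall_subset_closedBall hsr₂ hx)).1
  have hpos : ∀ x ∈ Metric.closedBall x₀ s, ∀ e : Fin (k + 2) → Eucl n, Orthonormal ℝ e →
      0 < ∑ i, secondDeriv θ x (e i) := by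
    intro x hx e he
    have h1 := sum_le_sum_of_abs_sub_le
      (hr₂s (Metric.closedBall_subset_closedBall hsr₂ hx)).2 he
    have h2 := hθ₀ e he
    have h3 : ((k : ℝ) + 2) * (τ / (2 * (k + 2))) = τ / 2 := by field_simp
    rw [Fintype.card_fin] at h1
    push_cast at h1
    linarith
  -- This is the gap between `u` and `θ` guaranteed on the sphere of radius `s`.
  set m := a * s ^ 2 with hm
  have hmpos : 0 < m := by positivity
  refine ⟨m / 4, by positivity, s, hspos, fun x₁ hx₁ => ?_⟩
  by_contra! hlt
  set d := Metric.infDist x₁ E with hd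
  have hdpos : 0 < d := (hEc.notMem_iff_infDist_pos ⟨x₀, hx₀⟩).1 hx₁.2
  -- An average of kernels with poles on `E` is at most `d^(-k)` at `x₁`, whatever the poles. So `β`
  -- can be fixed first, with `β G x₁ ≤ m / 4`, and the grid chosen afterwards so that `β G > m`
  -- near `E`.
  set β := m / 4 * d ^ k with hβ
  have hβpos : 0 < β := by positivity
  obtain ⟨S, Z, hSne, hZE, hZ⟩ := exists_grid_potential_large hk hR hΛ hgE hg (m / β)
  have hScard : (0 : ℝ) < S.card := by exact_mod_cast hSne.card_pos
  have hZne : ∀ x ∉ E, ∀ t ∈ S, x ≠ Z t := fun x hx t ht h => hx (h ▸ hZE t ht)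
  set G : Eucl n → ℝ := fun x =>
    (S.card : ℝ)⁻¹ * ∑ t ∈ S, rieszKernel (-(k : ℝ) / 2) (Z t) x with hG
  have hsumC : ∀ x ∉ E, ContDiffAt ℝ 2
      (fun x => ∑ t ∈ S, rieszKernel (-(k : ℝ) / 2) (Z t) x) x := fun x hx =>
    ContDiffAt.sum fun t ht => contDiffAt_rieszKernel _ (hZne x hx t ht)
  have hGC : ∀ x ∉ E, ContDiffAt ℝ 2 G x := fun x hx => contDiffAt_const.mul (hsumC x hx)
  have hG0 : ∀ x, 0 ≤ G x := fun x =>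
    mul_nonneg (by positivity) (Finset.sum_nonneg fun t _ => rieszKernel_nonneg _ _ _)
  have hGx₁ : G x₁ ≤ (d ^ k)⁻¹ := by
    rw [hG]
    dsimp only
    rw [inv_mul_le_iff₀ hScard]
    have h1 := Finset.sum_le_card_nsmul S (fun t => rieszKernel (-(k : ℝ) / 2) (Z t) x₁)
      ((d ^ k)⁻¹) fun t ht => rieszKernel_le hdpos (by
        rw [← dist_eq_norm]; exact Metric.infDist_le_dist_of_mem (hZE t ht))
    simpa using h1
  set f : Eucl n → ℝ := fun x => u x - θ x + β * G x with hf
  have huC : ∀ x ∈ O \ E, ContDiffAt ℝ 2 u x := fun x hx => hu.contDiffAt (hOE.mem_nhds hx)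
  have hθC : ∀ x ∈ O, ContDiffAt ℝ 2 θ x := fun x hx => hθ.contDiffAt (hO.mem_nhds hx)
  have hfC : ∀ x ∈ O \ E, ContDiffAt ℝ 2 f x := fun x hx =>
    ((huC x hx).sub (hθC x hx.1)).add (contDiffAt_const.mul (hGC x hx.2))
  have hfx₁ : f x₁ < m / 2 := by
    have h1 : β * G x₁ ≤ m / 4 := by
      calc β * G x₁ ≤ β * (d ^ k)⁻¹ := by gcongr
        _ = m / 4 := by rw [hβ]; field_simp
    simp only [hf]
    linarith
  obtain ⟨x, hx, hmin, -⟩ := exists_isLocalMin_of_large hEc (f := f) (x₀ := x₀) (r := s) (x₁ := x₁)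
    (fun x hx => (hfC x ⟨hsO x hx.1, hx.2⟩).continuousAt.continuousWithinAt)
    ⟨Metric.ball_subset_closedBall hx₁.1, hx₁.2⟩ (by
      intro z hz
      obtain ⟨σ, hσ, rfl⟩ := hgx z ⟨hz.1, Metric.closedBall_subset_closedBall hsr₁ hz.2⟩
      have hball : ∀ᶠ y in 𝓝[Eᶜ] (g σ), y ∈ Metric.ball x₀ r :=
        nhdsWithin_le_nhds (Metric.isOpen_ball.mem_nhds
          (Metric.closedBall_subset_ball hsr hz.2))
      filter_upwards [hZ σ hσ, hball, self_mem_nhdsWithin] with y hy hyb hyE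
      have h1 := hle y ⟨hyb, hyE⟩
      have h2 : m < β * G y := by rwa [div_lt_iff₀' hβpos] at hy
      have h3 : 0 ≤ a * ‖y - x₀‖ ^ 2 := by positivity
      refine hfx₁.trans ?_
      simp only [hf]
      linarith) (by
      intro y hy
      have hys : ‖y - x₀‖ = s := by rw [← dist_eq_norm]; exact hy.1
      have h1 := hle y ⟨by rw [Metric.mem_ball, dist_eq_norm, hys]; exact hsr, hy.2⟩
      rw [hys, ← hm] at h1
      have h2 : 0 ≤ β * G y := mul_nonneg hβpos.le (hG0 y)
      refine hfx₁.trans ?_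
      simp only [hf]
      linarith)
  have hxO : x ∈ O \ E := ⟨hsO x (Metric.ball_subset_closedBall hx.1), hx.2⟩
  -- On the span of the eigenvectors for the lowest `k + 2` eigenvalues of the Hessian of `u`, the
  -- Hessian of `f` has negative trace, which is impossible at a minimum.
  obtain ⟨e, he, hsum⟩ := exists_orthonormal_sum_quadForm_eq_lamSum
    (hessMat_mem_symMat (huC x hxO)) hkn
  have hu2 : ∑ i, secondDeriv u x (e i) ≤ 0 := by
    simp only [quadForm_hessMat (huC x hxO)] at hsum
    rw [hsum]; exact hlam x hxO
  have hf2 : ∀ ξ, secondDeriv f x ξ = secondDeriv u x ξ - secondDeriv θ x ξ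
      + β * ((S.card : ℝ)⁻¹ * ∑ t ∈ S, secondDeriv (rieszKernel (-(k : ℝ) / 2) (Z t)) x ξ) := by
    intro ξ
    rw [hf, secondDeriv_add ((huC x hxO).sub (hθC x hxO.1)) (contDiffAt_const.mul (hGC x hx.2)),
      secondDeriv_sub (huC x hxO) (hθC x hxO.1), secondDeriv_const_mul (hGC x hx.2),
      hG, secondDeriv_const_mul (hsumC x hx.2),
      secondDeriv_finset_sum S fun t ht => contDiffAt_rieszKernel _ (hZne x hx.2 t ht)]
  have hker : ∑ i, ∑ t ∈ S, secondDeriv (rieszKernel (-(k : ℝ) / 2) (Z t)) x (e i) ≤ 0 := by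
    rw [Finset.sum_comm]
    exact Finset.sum_nonpos fun t ht =>
      sum_secondDeriv_rieszKernel_nonpos k (hZne x hx.2 t ht) he
  have hfnonneg : 0 ≤ ∑ i, secondDeriv f x (e i) :=
    Finset.sum_nonneg fun i _ => hmin.secondDeriv_nonneg (hfC x hxO) (e i)
  simp only [hf2, Finset.sum_add_distrib, Finset.sum_sub_distrib, ← Finset.mul_sum] at hfnonneg
  have h1 := hpos x (Metric.ball_subset_closedBall hx.1) e he
  have h2 : β * ((S.card : ℝ)⁻¹ *
      ∑ i, ∑ t ∈ S, secondDeriv (rieszKernel (-(k : ℝ) / 2) (Z t)) x (e i)) ≤ 0 :=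
    mul_nonpos_of_nonneg_of_nonpos hβpos.le
      (mul_nonpos_of_nonneg_of_nonpos (by positivity) hker)
  linarith

end MinimumPrinciple

/-! ### The barriers and their derivatives -/

section Perturbation

variable {n : ℕ}

theorem secondDeriv_inner_left {y : Eucl n → Eucl n} {x : Eucl n} (hy : ContDiffAt ℝ 2 y x)
    (p ξ : Eucl n) :
    secondDeriv (fun z => inner ℝ p (y z)) x ξ = inner ℝ p (secondDeriv y x ξ) := by
  have h1 : fderiv ℝ (fun z => inner ℝ p (y z)) =ᶠ[𝓝 x]
      fun z => (innerSL ℝ p).comp (fderiv ℝ y z) := by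
    filter_upwards [hy.eventually_differentiableAt] with z hz
    exact ((innerSL ℝ p).hasFDerivAt.comp z hz.hasFDerivAt).fderiv
  have h2 := (ContinuousLinearMap.compL ℝ (Eucl n) (Eucl n) ℝ (innerSL ℝ p)).hasFDerivAt.comp x
    hy.differentiableAt_fderiv.hasFDerivAt
  have h3 : fderiv ℝ (fun z => (innerSL ℝ p).comp (fderiv ℝ y z)) x
      = (ContinuousLinearMap.compL ℝ (Eucl n) (Eucl n) ℝ (innerSL ℝ p)).comp
        (fderiv ℝ (fderiv ℝ y) x) := h2.fderiv
  rw [secondDeriv, h1.fderiv_eq, h3]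
  rfl

theorem fderiv_inner_left {y : Eucl n → Eucl n} {x : Eucl n} (hy : DifferentiableAt ℝ y x)
    (p : Eucl n) : fderiv ℝ (fun z => inner ℝ p (y z)) x = (innerSL ℝ p).comp (fderiv ℝ y x) :=
  ((innerSL ℝ p).hasFDerivAt.comp x hy.hasFDerivAt).fderiv

theorem contDiffAt_inner_left {y : Eucl n → Eucl n} {x : Eucl n} (hy : ContDiffAt ℝ 2 y x)
    (p : Eucl n) : ContDiffAt ℝ 2 (fun z => inner ℝ p (y z)) x :=
  contDiffAt_const.inner ℝ hy

/-- The remaining term `2⟨y, D²y⟩` vanishes with `y`, so at a zero of `y` the Hessian of `|y|²` sees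
only directions transversal to `ker Dy`. -/
theorem secondDeriv_norm_sq_of_eq_zero {y : Eucl n → Eucl n} {x : Eucl n}
    (hy : ContDiffAt ℝ 2 y x) (h0 : y x = 0) (ξ : Eucl n) :
    secondDeriv (fun z => ‖y z‖ ^ 2) x ξ = 2 * ‖fderiv ℝ y x ξ‖ ^ 2 := by
  have hq : ContDiffAt ℝ 2 (fun z => ‖y z‖ ^ 2) x := hy.norm_sq ℝ
  have h1 : (fun z => fderiv ℝ (fun z => ‖y z‖ ^ 2) z ξ) =ᶠ[𝓝 x]
      fun z => 2 * inner ℝ (y z) (fderiv ℝ y z ξ) := by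
    filter_upwards [hy.eventually_differentiableAt] with z hz
    rw [hz.hasFDerivAt.norm_sq.fderiv]
    simp
  have h2 : HasFDerivAt (fun z => fderiv ℝ (fun z => ‖y z‖ ^ 2) z ξ)
      ((fderiv ℝ (fderiv ℝ fun z => ‖y z‖ ^ 2) x).flip ξ) x := by
    simpa using hq.differentiableAt_fderiv.hasFDerivAt.clm_apply (hasFDerivAt_const ξ x)
  have h3 : HasFDerivAt (fun z => fderiv ℝ y z ξ) ((fderiv ℝ (fderiv ℝ y) x).flip ξ) x := by
    simpa using hy.differentiableAt_fderiv.hasFDerivAt.clm_apply (hasFDerivAt_const ξ x)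
  have h4 := ((hy.differentiableAt (by norm_num)).hasFDerivAt.inner ℝ h3).const_mul 2
  have h5 := DFunLike.congr_fun (h2.unique (h4.congr_of_eventuallyEq h1)) ξ
  rw [secondDeriv]
  rw [ContinuousLinearMap.flip_apply] at h5
  rw [h5]
  simp [h0, fderivInnerCLM_apply]

/-- The perturbation `(K/2)|y|² + ⟨p, y⟩ - a|x - x₀|²`. -/
noncomputable def perturbation (y : Eucl n → Eucl n) (x₀ : Eucl n) (K a : ℝ) (p x : Eucl n) : ℝ :=
  K / 2 * ‖y x‖ ^ 2 - a * ‖x - x₀‖ ^ 2 + inner ℝ p (y x)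

theorem contDiffAt_quadratic {y : Eucl n → Eucl n} {x : Eucl n} (hy : ContDiffAt ℝ 2 y x)
    (x₀ : Eucl n) (K a : ℝ) :
    ContDiffAt ℝ 2 (fun x => K * ‖y x‖ ^ 2 - a * ‖x - x₀‖ ^ 2) x :=
  (contDiffAt_const.mul (hy.norm_sq ℝ)).sub
    (contDiffAt_const.mul (contDiff_norm_sub_sq x₀).contDiffAt)

theorem contDiffAt_perturbation {y : Eucl n → Eucl n} {x : Eucl n} (hy : ContDiffAt ℝ 2 y x)
    (x₀ : Eucl n) (K a : ℝ) (p : Eucl n) : ContDiffAt ℝ 2 (perturbation y x₀ K a p) x :=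
  (contDiffAt_quadratic hy x₀ (K / 2) a).add (contDiffAt_inner_left hy p)

theorem secondDeriv_quadratic {y : Eucl n → Eucl n} {x₀ : Eucl n} (hy : ContDiffAt ℝ 2 y x₀)
    (h0 : y x₀ = 0) (K a : ℝ) (ξ : Eucl n) :
    secondDeriv (fun x => K * ‖y x‖ ^ 2 - a * ‖x - x₀‖ ^ 2) x₀ ξ
      = 2 * K * ‖fderiv ℝ y x₀ ξ‖ ^ 2 - 2 * a * ‖ξ‖ ^ 2 := by
  have h1 : ContDiffAt ℝ 2 (fun x => ‖y x‖ ^ 2) x₀ := hy.norm_sq ℝ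
  have h2 : ContDiffAt ℝ 2 (fun x => ‖x - x₀‖ ^ 2) x₀ := (contDiff_norm_sub_sq x₀).contDiffAt
  rw [secondDeriv_sub (contDiffAt_const.mul h1) (contDiffAt_const.mul h2),
    secondDeriv_const_mul h1, secondDeriv_const_mul h2, secondDeriv_norm_sq_of_eq_zero hy h0,
    secondDeriv_norm_sub_sq]
  ring

theorem fderiv_quadratic {y : Eucl n → Eucl n} {x₀ : Eucl n} (hy : ContDiffAt ℝ 2 y x₀)
    (h0 : y x₀ = 0) (K a : ℝ) :
    fderiv ℝ (fun x => K * ‖y x‖ ^ 2 - a * ‖x - x₀‖ ^ 2) x₀ = 0 := by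
  have hd := hy.differentiableAt (by norm_num)
  have h1 := hd.hasFDerivAt.norm_sq.const_mul K
  have h2 := (hasFDerivAt_norm_sub_sq x₀ x₀).const_mul a
  have h3 := (h1.sub h2).fderiv
  have h4 : (fun x => K * ‖y x‖ ^ 2 - a * ‖x - x₀‖ ^ 2)
    = ((fun x => K * ‖y x‖ ^ 2) - fun x => a * ‖x - x₀‖ ^ 2) := rfl
  rw [h4, h3, h0]
  simp

/-- If `K |Dy(x₀) ξ|² ≥ N(ξ, ξ) + δ|ξ|²`, then near `x₀` the Hessians of all perturbations with
small `p` exceed `N`, even after subtracting first order terms. -/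
theorem exists_perturbation_bounds {y : Eucl n → Eucl n} {x₀ : Eucl n} {O : Set (Eucl n)}
    (hO : O ∈ 𝓝 x₀) (hy : ContDiffAt ℝ 2 y x₀) (h0 : y x₀ = 0) {N : Mat n} {K δ Λ : ℝ}
    (hδ : 0 < δ) (hΛ : 0 < Λ)
    (hN : ∀ ξ, quadForm N ξ + δ * ‖ξ‖ ^ 2 ≤ K * ‖fderiv ℝ y x₀ ξ‖ ^ 2) :
    ∃ c > 0, ∃ r > 0, ∀ x ∈ Metric.closedBall x₀ r, x ∈ O ∧ ∀ p, ‖p‖ ≤ c →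
      |perturbation y x₀ K (δ / 4) p x| ≤ 1 ∧
      ‖fderiv ℝ (perturbation y x₀ K (δ / 4) p) x‖ ≤ 1 ∧
      ∀ ξ, quadForm N ξ + δ / 4 * ‖ξ‖ ^ 2 + Λ * (|perturbation y x₀ K (δ / 4) p x|
          + ‖fderiv ℝ (perturbation y x₀ K (δ / 4) p) x‖) * ‖ξ‖ ^ 2
        ≤ secondDeriv (perturbation y x₀ K (δ / 4) p) x ξ := by
  set h₀ : Eucl n → ℝ := fun x => K / 2 * ‖y x‖ ^ 2 - δ / 4 * ‖x - x₀‖ ^ 2 with hh₀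
  have hC₀ : ContDiffAt ℝ 2 h₀ x₀ := contDiffAt_quadratic hy x₀ (K / 2) (δ / 4)
  -- At `x₀` the Hessian exceeds `N` by `δ/2`. Half of this surplus is kept; the other half pays
  -- `2η` for the oscillation of the Hessian and the `p` term, and `4Λη` for the first order terms.
  obtain ⟨η, hη, hη1, hη2⟩ : ∃ η > 0, η ≤ 1 / 2 ∧ (2 + 4 * Λ) * η ≤ δ / 4 := by
    refine ⟨min (1 / 2) (δ / 4 / (2 + 4 * Λ)), by positivity, min_le_left _ _, ?_⟩
    rw [← le_div_iff₀' (by positivity)]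
    exact min_le_right _ _
  set B := ‖fderiv ℝ y x₀‖ + ‖fderiv ℝ (fderiv ℝ y) x₀‖ + 1 with hB
  have hBpos : 1 ≤ B := by
    have := norm_nonneg (fderiv ℝ y x₀)
    have := norm_nonneg (fderiv ℝ (fderiv ℝ y) x₀)
    linarith
  have e1 : ∀ᶠ x in 𝓝 x₀, |h₀ x| ≤ η := by
    have h1 : h₀ x₀ = 0 := by simp [hh₀, h0]
    have h2 := hC₀.continuousAt.eventually_norm_sub_lt hη
    rw [h1] at h2
    filter_upwards [h2] with x hx
    simpa using hx.le
  have e2 : ∀ᶠ x in 𝓝 x₀, ‖fderiv ℝ h₀ x‖ ≤ η := by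
    have h1 : fderiv ℝ h₀ x₀ = 0 := fderiv_quadratic hy h0 _ _
    have h2 := hC₀.differentiableAt_fderiv.continuousAt.eventually_norm_sub_lt hη
    rw [h1] at h2
    filter_upwards [h2] with x hx
    simpa using hx.le
  have e3 : ∀ᶠ x in 𝓝 x₀, ‖y x‖ ≤ B := by
    have h2 := hy.continuousAt.eventually_norm_sub_lt one_pos
    rw [h0] at h2
    filter_upwards [h2] with x hx
    simp only [sub_zero] at hx
    linarith
  have e4 : ∀ᶠ x in 𝓝 x₀, ‖fderiv ℝ y x‖ ≤ B := by
    have h2 := hy.differentiableAt_fderiv.continuousAt.eventually_norm_sub_lt one_pos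
    filter_upwards [h2] with x hx
    have h3 := norm_le_norm_sub_add (fderiv ℝ y x) (fderiv ℝ y x₀)
    have := norm_nonneg (fderiv ℝ (fderiv ℝ y) x₀)
    linarith
  have e5 : ∀ᶠ x in 𝓝 x₀, ‖fderiv ℝ (fderiv ℝ y) x‖ ≤ B := by
    have h2 := ContinuousAt.eventually_norm_sub_lt (G := Eucl n →L[ℝ] Eucl n →L[ℝ] Eucl n)
      hy.continuousAt_fderiv_fderiv one_pos
    filter_upwards [h2] with x hx
    have h3 := norm_le_norm_sub_add (fderiv ℝ (fderiv ℝ y) x) (fderiv ℝ (fderiv ℝ y) x₀)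
    have := norm_nonneg (fderiv ℝ y x₀)
    linarith
  obtain ⟨r, hr, hrs⟩ := Metric.nhds_basis_closedBall.mem_iff.1
    (Filter.inter_mem hO ((hy.eventually (by simp)).and (e1.and (e2.and (e3.and (e4.and (e5.and
      (hC₀.eventually_abs_secondDeriv_sub_le hη))))))))
  refine ⟨η / B, by positivity, r, hr, fun x hx => ⟨(hrs hx).1, fun p hp => ?_⟩⟩
  obtain ⟨hyx, h1, h2, h3, h4, h5, h6⟩ := (hrs hx).2
  have hcB : ‖p‖ * B ≤ η := by rwa [le_div_iff₀ (by positivity)] at hp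
  have hp0 := norm_nonneg p
  have hi1 : |inner ℝ p (y x)| ≤ η :=
    (abs_real_inner_le_norm _ _).trans ((by gcongr : ‖p‖ * ‖y x‖ ≤ ‖p‖ * B).trans hcB)
  have hi2 : ‖(innerSL ℝ p).comp (fderiv ℝ y x)‖ ≤ η := by
    refine (ContinuousLinearMap.opNorm_comp_le _ _).trans ?_
    rw [innerSL_apply_norm]
    exact (by gcongr : ‖p‖ * ‖fderiv ℝ y x‖ ≤ ‖p‖ * B).trans hcB
  have hi3 : ∀ ξ, |inner ℝ p (secondDeriv y x ξ)| ≤ η * ‖ξ‖ ^ 2 := fun ξ => by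
    refine (abs_real_inner_le_norm _ _).trans ?_
    have h7 : ‖secondDeriv y x ξ‖ ≤ B * ‖ξ‖ ^ 2 := by
      refine ((fderiv ℝ (fderiv ℝ y) x).le_opNorm₂ ξ ξ).trans ?_
      rw [mul_assoc, ← pow_two]
      gcongr
    calc ‖p‖ * ‖secondDeriv y x ξ‖ ≤ ‖p‖ * (B * ‖ξ‖ ^ 2) := by gcongr
      _ = ‖p‖ * B * ‖ξ‖ ^ 2 := by ring
      _ ≤ _ := by gcongr
  have hC₀x : ContDiffAt ℝ 2 h₀ x := contDiffAt_quadratic hyx x₀ (K / 2) (δ / 4)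
  have hval : |perturbation y x₀ K (δ / 4) p x| ≤ 2 * η := by
    have : perturbation y x₀ K (δ / 4) p x = h₀ x + inner ℝ p (y x) := rfl
    rw [this]
    exact (abs_add_le _ _).trans (by linarith)
  have hder : ‖fderiv ℝ (perturbation y x₀ K (δ / 4) p) x‖ ≤ 2 * η := by
    have : fderiv ℝ (perturbation y x₀ K (δ / 4) p) x
        = fderiv ℝ h₀ x + (innerSL ℝ p).comp (fderiv ℝ y x) := by
      rw [← fderiv_inner_left (hyx.differentiableAt (by norm_num))]
      exact fderiv_fun_add (hC₀x.differentiableAt (by norm_num))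
        ((contDiffAt_inner_left hyx p).differentiableAt (by norm_num))
    rw [this]
    exact (norm_add_le _ _).trans (by linarith)
  refine ⟨by linarith, by linarith, fun ξ => ?_⟩
  have hsec : secondDeriv (perturbation y x₀ K (δ / 4) p) x ξ
      = secondDeriv h₀ x ξ + inner ℝ p (secondDeriv y x ξ) := by
    rw [← secondDeriv_inner_left hyx]
    exact secondDeriv_add hC₀x (contDiffAt_inner_left hyx p) ξ
  have h7 := (abs_le.1 (h6 ξ)).1
  have h8 := (abs_le.1 (hi3 ξ)).1
  have h9 : secondDeriv h₀ x₀ ξ = K * ‖fderiv ℝ y x₀ ξ‖ ^ 2 - δ / 2 * ‖ξ‖ ^ 2 := by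
    rw [hh₀, secondDeriv_quadratic hy h0]; ring
  have h10 := hN ξ
  have h11 : Λ * (|perturbation y x₀ K (δ / 4) p x|
      + ‖fderiv ℝ (perturbation y x₀ K (δ / 4) p) x‖) * ‖ξ‖ ^ 2 ≤ Λ * (4 * η) * ‖ξ‖ ^ 2 := by
    gcongr
    linarith
  have h12 : (2 + 4 * Λ) * η * ‖ξ‖ ^ 2 ≤ δ / 4 * ‖ξ‖ ^ 2 := by gcongr
  rw [hsec]
  nlinarith

end Perturbation

/-! ### Comparing the operators at a touching point -/

section Operator

variable {n : ℕ}

/-- Local Lipschitz bound for the zeroth order term, as quadratic forms. -/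
theorem IsLocLipSym.exists_quadForm_bound {L : Eucl n × ℝ × Eucl n → Mat n} (hL : IsLocLipSym L)
    (P₀ : Eucl n × ℝ × Eucl n) :
    ∃ Λ > 0, ∃ ρ > 0, ∀ P ∈ Metric.ball P₀ ρ, ∀ P' ∈ Metric.ball P₀ ρ, ∀ ξ,
      |quadForm (L P - L P') ξ| ≤ Λ * dist P P' * ‖ξ‖ ^ 2 := by
  choose B t ht hB using fun i j => hL.2 i j P₀
  have h1 : (⋂ i, ⋂ j, t i j) ∈ 𝓝 P₀ :=
    Filter.iInter_mem.2 fun i => Filter.iInter_mem.2 fun j => ht i j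
  obtain ⟨ρ, hρ, hρt⟩ := Metric.mem_nhds_iff.1 h1
  have hBle : ∀ i j, (B i j : ℝ) ≤ ∑ i, ∑ j, (B i j : ℝ) := fun i j =>
    (Finset.single_le_sum (f := fun j => (B i j : ℝ)) (fun j _ => (B i j).2)
      (Finset.mem_univ j)).trans
    (Finset.single_le_sum (f := fun i => ∑ j, (B i j : ℝ))
      (fun i _ => Finset.sum_nonneg fun j _ => (B i j).2) (Finset.mem_univ i))
  set b := ∑ i, ∑ j, (B i j : ℝ)
  have hb : 0 ≤ b := Finset.sum_nonneg fun i _ => Finset.sum_nonneg fun j _ => (B i j).2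
  refine ⟨n ^ 2 * b + 1, by positivity, ρ, hρ, fun P hP P' hP' ξ => ?_⟩
  have h2 := abs_quadForm_le (L P - L P') (b * dist P P') (fun i j => by
    have h3 := (hB i j).dist_le_mul P (mem_iInter₂.1 (hρt hP) i j) P'
      (mem_iInter₂.1 (hρt hP') i j)
    rw [Real.dist_eq] at h3
    exact h3.trans (by gcongr; exact hBle i j)) ξ
  refine h2.trans ?_
  have h4 : 0 ≤ dist P P' * ‖ξ‖ ^ 2 := by positivity
  nlinarith

theorem ATilde_mem_symMat {L : Eucl n × ℝ × Eucl n → Mat n} (hL : IsLocLipSym L)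
    {u : Eucl n → ℝ} {x : Eucl n} (hu : ContDiffAt ℝ 2 u x) : ATilde L u x ∈ symMat n := by
  have h1 : (hessMat u x).IsSymm := hessMat_mem_symMat hu
  have h2 : (L (x, u x, gradient u x)).IsSymm := hL.1 _
  exact h1.neg.add h2

theorem norm_gradient_sub (u v : Eucl n → ℝ) (x : Eucl n) :
    ‖gradient u x - gradient v x‖ = ‖fderiv ℝ u x - fderiv ℝ v x‖ := by
  rw [gradient, gradient, ← map_sub, LinearIsometryEquiv.norm_map]

/-- A perturbation whose Hessian strictly exceeds a matrix admissible in Property `P_k` (modulo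
first order terms) cannot touch `u - v` from below. -/
theorem not_isLocalMin_sub_perturbation {U : Set (Mat n)} (hcone : ConeCondition U)
    {L : Eucl n × ℝ × Eucl n → Mat n} (hL : IsLocLipSym L)
    {u v h : Eucl n → ℝ} {x : Eucl n} (hu : ContDiffAt ℝ 2 u x) (hv : ContDiffAt ℝ 2 v x)
    (hh : ContDiffAt ℝ 2 h x) {N : Mat n} (hN : N ∈ symMat n) {C ε κ Λ : ℝ} (hε : 0 < ε)
    (hκ : 0 < κ) (hΛ : 0 ≤ Λ)
    (hPC : ∀ M ∈ closure U, (C • (1 : Mat n) - M).PosSemidef → M + ε • N ∈ U)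
    (hεN : ∀ ξ, -(ε * quadForm N ξ) ≤ ‖ξ‖ ^ 2)
    (hess : ∀ ξ, quadForm N ξ + κ * ‖ξ‖ ^ 2 + Λ * (|h x| + ‖fderiv ℝ h x‖) * ‖ξ‖ ^ 2
      ≤ secondDeriv h x ξ)
    (hlip : ∀ P, dist (x, v x, gradient v x) P ≤ ε * (|h x| + ‖fderiv ℝ h x‖) → ∀ ξ,
      |quadForm (L (x, v x, gradient v x) - L P) ξ|
        ≤ Λ * dist (x, v x, gradient v x) P * ‖ξ‖ ^ 2)
    (hbd : ∀ ξ, quadForm (ATilde L v x) ξ ≤ (C - 1) * ‖ξ‖ ^ 2)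
    (hval : |u x - v x| ≤ ε * |h x|)
    (hAu : ATilde L u x ∈ closure U) (hAv : ATilde L v x ∉ U) :
    ¬ IsLocalMin (fun z => u z - v z - ε * h z) x := by
  intro hmin
  have huv := hu.sub hv
  have hεh : ContDiffAt ℝ 2 (fun z => ε * h z) x := contDiffAt_const.mul hh
  have hsec : ∀ ξ, ε * secondDeriv h x ξ ≤ secondDeriv u x ξ - secondDeriv v x ξ := fun ξ => by
    have h1 := hmin.secondDeriv_nonneg (huv.sub hεh) ξ
    rw [secondDeriv_sub huv hεh, secondDeriv_sub hu hv, secondDeriv_const_mul hh] at h1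
    linarith
  have hgrad : fderiv ℝ u x - fderiv ℝ v x = ε • fderiv ℝ h x := by
    have h1 := hmin.fderiv_eq_zero
    have du := hu.differentiableAt (by norm_num)
    have dv := hv.differentiableAt (by norm_num)
    have dh := hh.differentiableAt (by norm_num)
    rw [fderiv_fun_sub (du.fun_sub dv) (dh.const_mul ε), fderiv_fun_sub du dv,
      fderiv_const_mul dh] at h1
    exact sub_eq_zero.1 h1
  have hdist : dist (x, v x, gradient v x) (x, u x, gradient u x)
      ≤ ε * (|h x| + ‖fderiv ℝ h x‖) := by
    have h0 : 0 ≤ ε * ‖fderiv ℝ h x‖ := by positivity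
    have h0' : 0 ≤ ε * |h x| := by positivity
    rw [Prod.dist_eq, Prod.dist_eq, dist_self, max_le_iff, max_le_iff, mul_add]
    refine ⟨by linarith, ?_, ?_⟩
    · rw [dist_comm, Real.dist_eq]; dsimp only; linarith
    · rw [dist_comm, dist_eq_norm]
      dsimp only
      rw [norm_gradient_sub, hgrad, norm_smul, Real.norm_of_nonneg hε.le]
      linarith
  set M := ATilde L u x with hM
  set V := ATilde L v x with hV
  have hMs : M ∈ symMat n := ATilde_mem_symMat hL hu
  have hVs : V ∈ symMat n := ATilde_mem_symMat hL hv
  have hVM : ∀ ξ, quadForm V ξ - quadForm M ξ = secondDeriv u x ξ - secondDeriv v x ξ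
      + quadForm (L (x, v x, gradient v x) - L (x, u x, gradient u x)) ξ := fun ξ => by
    rw [hV, hM, ATilde, ATilde, quadForm_add, quadForm_add, quadForm_neg, quadForm_neg,
      quadForm_hessMat hu, quadForm_hessMat hv, quadForm_sub]
    ring
  -- The Lipschitz error is at most `Λ ε (|h| + |∇h|)`, which is the surplus built into `hess`; what
  -- survives is `ε (N + κ)`.
  have hkey : ∀ ξ, ε * quadForm N ξ + ε * κ * ‖ξ‖ ^ 2 ≤ quadForm V ξ - quadForm M ξ := fun ξ => by
    have h1 := (abs_le.1 (hlip _ hdist ξ)).1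
    have h2 : Λ * dist (x, v x, gradient v x) (x, u x, gradient u x) * ‖ξ‖ ^ 2
        ≤ Λ * (ε * (|h x| + ‖fderiv ℝ h x‖)) * ‖ξ‖ ^ 2 := by gcongr
    have h3 := mul_le_mul_of_nonneg_left (hess ξ) hε.le
    have h4 := hsec ξ
    rw [hVM]
    nlinarith
  have hsmul : ∀ (c : ℝ) {A : Mat n}, A ∈ symMat n → c • A ∈ symMat n := fun c A hA =>
    Matrix.IsSymm.smul hA c
  -- Since `M ≤ V - ε N`, with `V ≤ C - 1` and `-ε N ≤ 1`, the upper bound `M ≤ C` needed in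
  -- Property `P_k` is automatic.
  have hMU : M + ε • N ∈ U := by
    refine hPC M hAu (posSemidef_of_quadForm_nonneg ?_ fun ξ => ?_)
    · exact Matrix.IsSymm.sub (hsmul C (Matrix.isSymm_one)) hMs
    · rw [quadForm_sub, quadForm_smul, quadForm_one]
      have h1 := hkey ξ
      have h2 := hbd ξ
      have h3 := hεN ξ
      have h4 : 0 ≤ ε * κ * ‖ξ‖ ^ 2 := by positivity
      linarith
  have hpd : (V - (M + ε • N)).PosDef := by
    refine posDef_of_quadForm_pos (Matrix.IsSymm.sub hVs (Matrix.IsSymm.add hMs (hsmul ε hN)))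
      fun ξ hξ => ?_
    rw [quadForm_sub, quadForm_add, quadForm_smul]
    have h1 := hkey ξ
    have h2 : 0 < ‖ξ‖ := norm_pos_iff.2 hξ
    have h4 : 0 < ε * κ * ‖ξ‖ ^ 2 := by positivity
    linarith
  have := hcone _ hMU _ hpd
  rw [add_sub_cancel] at this
  exact hAv this

end Operator

/-! ### Linear growth, the local lower bound and the theorem -/

section Main

variable {n : ℕ}

theorem exists_abs_quadForm_le (M : Mat n) : ∃ b > 0, ∀ ξ, |quadForm M ξ| ≤ b * ‖ξ‖ ^ 2 := by
  have hle : ∀ i j, |M i j| ≤ ∑ i, ∑ j, |M i j| := fun i j =>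
    (Finset.single_le_sum (f := fun j => |M i j|) (fun j _ => abs_nonneg _)
      (Finset.mem_univ j)).trans
    (Finset.single_le_sum (f := fun i => ∑ j, |M i j|)
      (fun i _ => Finset.sum_nonneg fun j _ => abs_nonneg _) (Finset.mem_univ i))
  have hb : 0 ≤ ∑ i, ∑ j, |M i j| :=
    Finset.sum_nonneg fun i _ => Finset.sum_nonneg fun j _ => abs_nonneg _
  refine ⟨n ^ 2 * (∑ i, ∑ j, |M i j|) + 1, by positivity, fun ξ => ?_⟩
  have h1 := abs_quadForm_le M _ hle ξ
  have h2 : 0 ≤ ‖ξ‖ ^ 2 := by positivity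
  nlinarith

theorem ContDiffAt.continuousAt_gradient {v : Eucl n → ℝ} {x : Eucl n} (hv : ContDiffAt ℝ 2 v x) :
    ContinuousAt (gradient v) x :=
  (InnerProductSpace.toDual ℝ (Eucl n)).symm.continuous.continuousAt.comp
    hv.differentiableAt_fderiv.continuousAt

/-- `Ã^v` is locally bounded above. -/
theorem eventually_quadForm_ATilde_le {L : Eucl n × ℝ × Eucl n → Mat n} (hL : IsLocLipSym L)
    {v : Eucl n → ℝ} {x₀ : Eucl n} (hv : ContDiffAt ℝ 2 v x₀) :
    ∃ C > 0, ∀ᶠ x in 𝓝 x₀, ∀ ξ, quadForm (ATilde L v x) ξ ≤ C * ‖ξ‖ ^ 2 := by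
  obtain ⟨Λ, hΛ, ρ, hρ, hlip⟩ := hL.exists_quadForm_bound (x₀, v x₀, gradient v x₀)
  obtain ⟨b, hb, hbL⟩ := exists_abs_quadForm_le (L (x₀, v x₀, gradient v x₀))
  have hP : ContinuousAt (fun x => (x, v x, gradient v x)) x₀ :=
    continuousAt_id.prodMk (hv.continuousAt.prodMk hv.continuousAt_gradient)
  refine ⟨‖fderiv ℝ (fderiv ℝ v) x₀‖ + 1 + Λ * ρ + b, by positivity, ?_⟩
  filter_upwards [hv.eventually (by simp), hv.eventually_abs_secondDeriv_sub_le one_pos,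
    hP.preimage_mem_nhds (Metric.ball_mem_nhds _ hρ)] with x h1 h2 h3 ξ
  have h4 := hlip _ h3 _ (Metric.mem_ball_self hρ) ξ
  have h5 : Λ * dist (x, v x, gradient v x) (x₀, v x₀, gradient v x₀) * ‖ξ‖ ^ 2
      ≤ Λ * ρ * ‖ξ‖ ^ 2 := by
    gcongr; exact (Metric.mem_ball.1 h3).le
  rw [quadForm_sub] at h4
  rw [ATilde, quadForm_add, quadForm_neg, quadForm_hessMat h1]
  have h6 := (abs_le.1 (h2 ξ)).1
  have h7 := (abs_le.1 (abs_secondDeriv_le v x₀ ξ)).1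
  have h8 := (abs_le.1 (hbL ξ)).2
  have h9 := (abs_le.1 h4).2
  linarith

/-- Under Property `P_k`, `u - v` grows linearly away from `E`, up to a quadratic error. -/
theorem exists_linear_growth {k : ℕ} {Ω E O : Set (Eucl n)} (hΩ : IsOpen Ω) (hE : IsClosed E)
    (hEΩ : E ⊆ Ω) {x₀ : Eucl n} (hx₀ : x₀ ∈ E) (hO : IsOpen O) (hx₀O : x₀ ∈ O)
    {y : Eucl n → Eucl n} (hy : ContDiffOn ℝ 2 y O) (hyE : ∀ x ∈ O, x ∈ E ↔ y x = 0)
    (hT : Module.finrank ℝ (LinearMap.ker (fderiv ℝ y x₀ : Eucl n →ₗ[ℝ] Eucl n)) = k)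
    {U : Set (Mat n)} (hcone : ConeCondition U) (hP : PropertyP k U)
    {L : Eucl n × ℝ × Eucl n → Mat n} (hL : IsLocLipSym L) {u v : Eucl n → ℝ}
    (hu : ContDiffOn ℝ 2 u (Ω \ E)) (hv : ContDiffOn ℝ 2 v Ω)
    (hAu : ∀ x ∈ Ω \ E, ATilde L u x ∈ closure U) (hAv : ∀ x ∈ Ω, ATilde L v x ∉ U)
    (huv : ∀ x ∈ Ω \ E, v x < u x) :
    ∃ ε > 0, ∃ c > 0, ∃ a > 0, ∃ r > 0, ∀ x ∈ Metric.closedBall x₀ r \ E,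
      v x + ε * (c * ‖y x‖ - a * ‖x - x₀‖ ^ 2) ≤ u x := by
  have hΩE : IsOpen (Ω \ E) := hΩ.sdiff hE
  have huC : ∀ x ∈ Ω \ E, ContDiffAt ℝ 2 u x := fun x hx => hu.contDiffAt (hΩE.mem_nhds hx)
  have hvC : ∀ x ∈ Ω, ContDiffAt ℝ 2 v x := fun x hx => hv.contDiffAt (hΩ.mem_nhds hx)
  have hyC : ∀ x ∈ O, ContDiffAt ℝ 2 y x := fun x hx => hy.contDiffAt (hO.mem_nhds hx)
  have hv₀ := hvC x₀ (hEΩ hx₀)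
  have hy₀ : y x₀ = 0 := (hyE x₀ hx₀O).1 hx₀
  obtain ⟨Λ, hΛ, ρ, hρ, hlip⟩ := hL.exists_quadForm_bound (x₀, v x₀, gradient v x₀)
  obtain ⟨C, hC, hCv⟩ := eventually_quadForm_ATilde_le hL hv₀
  obtain ⟨δ, hδ, ε₀, hε₀, hPU⟩ := hP (C + 1) (by positivity)
  obtain ⟨K, hK, N, hN, hN1, hN2, hNT⟩ := exists_symMat_quadForm_le (fderiv ℝ y x₀) hT hδ
  obtain ⟨b, hb, hbN⟩ := exists_abs_quadForm_le N
  have hPc : ContinuousAt (fun x => (x, v x, gradient v x)) x₀ :=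
    continuousAt_id.prodMk (hv₀.continuousAt.prodMk hv₀.continuousAt_gradient)
  obtain ⟨c, hc, r, hr, hpert⟩ := exists_perturbation_bounds
    (Filter.inter_mem (hO.mem_nhds hx₀O) (Filter.inter_mem (hΩ.mem_nhds (hEΩ hx₀))
      (Filter.inter_mem (hPc.preimage_mem_nhds (Metric.ball_mem_nhds _ (half_pos hρ))) hCv)))
    (hyC x₀ hx₀O) hy₀ hδ hΛ hNT
  set B := Metric.closedBall x₀ r
  have hBO : ∀ x ∈ B, x ∈ O := fun x hx => (hpert x hx).1.1
  have hBΩ : ∀ x ∈ B, x ∈ Ω := fun x hx => (hpert x hx).1.2.1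
  have hB3 : ∀ x ∈ B, (x, v x, gradient v x) ∈ Metric.ball (x₀, v x₀, gradient v x₀) (ρ / 2) :=
    fun x hx => (hpert x hx).1.2.2.1
  have hBC : ∀ x ∈ B, ∀ ξ, quadForm (ATilde L v x) ξ ≤ C * ‖ξ‖ ^ 2 :=
    fun x hx => (hpert x hx).1.2.2.2
  set h : Eucl n → Eucl n → ℝ := fun p => perturbation y x₀ K (δ / 4) p with hh
  have hhC : ∀ p, ∀ x ∈ B, ContDiffAt ℝ 2 (h p) x := fun p x hx =>
    contDiffAt_perturbation (hyC x (hBO x hx)) x₀ K (δ / 4) p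
  have hwC : ∀ x ∈ B \ E, ContDiffAt ℝ 2 (fun z => u z - v z) x := fun x hx =>
    (huC x ⟨hBΩ x hx.1, hx.2⟩).sub (hvC x (hBΩ x hx.1))
  have hyB : ContinuousOn y B := hy.continuousOn.mono hBO
  -- Only on this part of the sphere can some `h_p` be positive. It is compact and misses `E`, where
  -- `y = 0`, so `u - v` has a positive minimum there; this yields one `m` for all `p`.
  obtain ⟨m, hm, hmZ⟩ : ∃ m > 0, ∀ x ∈ Metric.sphere x₀ r,
      δ / 4 * r ^ 2 ≤ K / 2 * ‖y x‖ ^ 2 + c * ‖y x‖ → m ≤ u x - v x := by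
    let Z : Set (Eucl n) := {x ∈ B | δ / 4 * r ^ 2 ≤ K / 2 * ‖y x‖ ^ 2 + c * ‖y x‖}
    have hZc : IsCompact Z := (isCompact_closedBall x₀ r).of_isClosed_subset
      (Metric.isClosed_closedBall.isClosed_le continuousOn_const (by fun_prop)) fun x hx => hx.1
    have hZE : Z ⊆ B \ E := fun x hx => ⟨hx.1, fun hxE => by
      have h1 := hx.2
      rw [(hyE x (hBO x hx.1)).1 hxE] at h1
      have : 0 < δ / 4 * r ^ 2 := by positivity
      simp at h1
      linarith⟩
    rcases Z.eq_empty_or_nonempty with hZ | hZ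
    · refine ⟨1, one_pos, fun x hx hx2 => ?_⟩
      have : x ∈ Z := ⟨Metric.sphere_subset_closedBall hx, hx2⟩
      rw [hZ] at this
      exact this.elim
    · obtain ⟨z, hz, hzmin⟩ := hZc.exists_isMinOn hZ
        (fun x hx => (hwC x (hZE hx)).continuousAt.continuousWithinAt)
      refine ⟨u z - v z, sub_pos.2 (huv z ⟨hBΩ z hz.1, (hZE hz).2⟩), fun x hx hx2 => ?_⟩
      exact hzmin ⟨Metric.sphere_subset_closedBall hx, hx2⟩
  -- The four bounds serve, in order: Property `P_k`; keeping the 1-jet of `u` in the ball where `L`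
  -- is Lipschitz, as `|h| + |∇h| ≤ 2`; beating `ε h ≤ ε` on the sphere; and `-ε N ≤ 1`.
  obtain ⟨ε, hε, hε1, hε2, hε3, hε4⟩ : ∃ ε > 0, ε < ε₀ ∧ 2 * ε < ρ / 2 ∧ ε < m ∧ ε * b ≤ 1 := by
    refine ⟨min (ε₀ / 2) (min (ρ / 8) (min (m / 2) (1 / b))), by positivity, ?_, ?_, ?_, ?_⟩
    · exact (min_le_left _ _).trans_lt (by linarith)
    · have := (min_le_right (ε₀ / 2) (min (ρ / 8) (min (m / 2) (1 / b)))).trans (min_le_left _ _)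
      linarith
    · have := (min_le_right (ε₀ / 2) (min (ρ / 8) (min (m / 2) (1 / b)))).trans
        ((min_le_right _ _).trans (min_le_left _ _))
      linarith
    · rw [← le_div_iff₀ hb]
      exact (min_le_right _ _).trans ((min_le_right _ _).trans (min_le_right _ _))
  have hclaim : ∀ p, ‖p‖ ≤ c → ∀ x ∈ B \ E, 0 ≤ u x - v x - ε * h p x := by
    intro p hp x₁ hx₁
    by_contra! hneg
    set f : Eucl n → ℝ := fun z => u z - v z - ε * h p z with hf
    have hfC : ∀ x ∈ B \ E, ContDiffAt ℝ 2 f x := fun x hx =>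
      (hwC x hx).sub (contDiffAt_const.mul (hhC p x hx.1))
    obtain ⟨x, hx, hmin, hfx⟩ := exists_isLocalMin_of_large hE (f := f)
      (fun x hx => (hfC x hx).continuousAt.continuousWithinAt) hx₁ (by
        intro z hz
        -- Nothing is known of `u` near `E` beyond `u > v`; a barrier nonpositive on `E` is enough,
        -- because the value at `x₁` is strictly negative.
        have hhz : ε * h p z ≤ 0 := by
          refine mul_nonpos_of_nonneg_of_nonpos hε.le ?_
          simp only [hh, perturbation, (hyE z (hBO z hz.2)).1 hz.1, norm_zero, inner_zero_right]
          have : 0 ≤ δ / 4 * ‖z - x₀‖ ^ 2 := by positivity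
          linarith
        have h1 : ∀ᶠ q in 𝓝 z, ε * h p q < -f x₁ :=
          (continuousAt_const.mul (hhC p z hz.2).continuousAt).eventually_lt_const
            (hhz.trans_lt (neg_pos.2 hneg))
        filter_upwards [nhdsWithin_le_nhds h1,
          nhdsWithin_le_nhds (hΩ.mem_nhds (hBΩ z hz.2)), self_mem_nhdsWithin] with q h2 h3 h4
        have h5 := huv q ⟨h3, h4⟩
        simp only [hf] at h2 ⊢
        linarith) (by
        intro x hx
        have hxB : x ∈ B := Metric.sphere_subset_closedBall hx.1
        refine hneg.trans ?_
        have hw : 0 < u x - v x := sub_pos.2 (huv x ⟨hBΩ x hxB, hx.2⟩)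
        by_cases hxZ : δ / 4 * r ^ 2 ≤ K / 2 * ‖y x‖ ^ 2 + c * ‖y x‖
        · have h1 := hmZ x hx.1 hxZ
          have h2 := (abs_le.1 ((hpert x hxB).2 p hp).1).2
          have h3 : ε * h p x ≤ ε * 1 := by gcongr
          simp only [hf]; linarith
        · have h1 : h p x ≤ 0 := by
            have h2 : inner ℝ p (y x) ≤ c * ‖y x‖ :=
              (real_inner_le_norm _ _).trans (by gcongr)
            have h3 : ‖x - x₀‖ = r := by rw [← dist_eq_norm]; exact hx.1
            simp only [hh, perturbation, h3]
            linarith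
          have h2 := mul_nonpos_of_nonneg_of_nonpos hε.le h1
          simp only [hf]; linarith)
    have hxB : x ∈ B := Metric.ball_subset_closedBall hx.1
    have hxΩ : x ∈ Ω := hBΩ x hxB
    obtain ⟨hb1, hb2, hb3⟩ := (hpert x hxB).2 p hp
    have hw : 0 < u x - v x := sub_pos.2 (huv x ⟨hxΩ, hx.2⟩)
    refine not_isLocalMin_sub_perturbation hcone hL (huC x ⟨hxΩ, hx.2⟩) (hvC x hxΩ) (hhC p x hxB)
      hN hε (by positivity : 0 < δ / 4) hΛ.le (C := C + 1)
      (fun M hM hCM => hPU ε hε hε1 N hN M hM hCM hN1 hN2) (fun ξ => ?_) hb3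
      (fun P hPd => ?_) (fun ξ => ?_) ?_ (hAu x ⟨hxΩ, hx.2⟩) (hAv x hxΩ) hmin
    · have h1 := (abs_le.1 (hbN ξ)).1
      have h2 : 0 ≤ ‖ξ‖ ^ 2 := by positivity
      nlinarith
    · have h1 : dist (x, v x, gradient v x) P < ρ / 2 := by
        refine hPd.trans_lt (lt_of_le_of_lt ?_ hε2)
        rw [mul_comm 2 ε]
        gcongr
        linarith
      have h2 := Metric.mem_ball.1 (hB3 x hxB)
      refine hlip _ (Metric.ball_subset_ball (by linarith) (hB3 x hxB)) P ?_
      have h3 := dist_triangle_left P (x₀, v x₀, gradient v x₀) (x, v x, gradient v x)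
      rw [Metric.mem_ball]
      linarith
    · simpa using hBC x hxB ξ
    · have h1 : u x - v x ≤ ε * h p x := by
        have := hfx.trans hneg.le
        simp only [hf] at this
        linarith
      rw [abs_of_pos hw]
      exact h1.trans (by gcongr; exact le_abs_self _)
  refine ⟨ε, hε, c, hc, δ / 4, by positivity, r, hr, fun x hx => ?_⟩
  have hyx : 0 < ‖y x‖ := norm_pos_iff.2 fun h0 => hx.2 ((hyE x (hBO x hx.1)).2 h0)
  -- As `ε` does not depend on `p`, the vector `p` may depend on `x`: this one maximizes `⟨p, y x⟩`
  -- among `‖p‖ ≤ c`.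
  have h1 := hclaim ((c / ‖y x‖) • y x) (by
    rw [norm_smul, Real.norm_of_nonneg (by positivity), div_mul_cancel₀ _ hyx.ne']) x hx
  simp only [hh, perturbation, inner_smul_left, real_inner_self_eq_norm_sq] at h1
  have h2 : (starRingEnd ℝ) (c / ‖y x‖) * ‖y x‖ ^ 2 = c * ‖y x‖ := by
    simp; field_simp
  rw [h2] at h1
  have h3 : 0 ≤ ε * (K / 2 * ‖y x‖ ^ 2) := by positivity
  linarith

/-- Near each point of `E`, the difference `u - v` is bounded below by a positive constant. -/
theorem exists_pos_add_le_near_point {k : ℕ} (hk : 1 ≤ k) (hkn : k + 2 ≤ n)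
    {Ω E : Set (Eucl n)} (hΩ : IsOpen Ω) (hE : IsSmoothClosedSubmanifold k E) (hEΩ : E ⊆ Ω)
    {U : Set (Mat n)} (hcone : ConeCondition U) (hP : PropertyP k U)
    {L : Eucl n × ℝ × Eucl n → Mat n} (hL : IsLocLipSym L) {u v : Eucl n → ℝ}
    (hu : ContDiffOn ℝ 2 u (Ω \ E)) (hv : ContDiffOn ℝ 2 v Ω)
    (hlam : ∀ x ∈ Ω \ E, lamSum (k + 2) (hessMat u x) ≤ 0)
    (hAu : ∀ x ∈ Ω \ E, ATilde L u x ∈ closure U) (hAv : ∀ x ∈ Ω, ATilde L v x ∉ U)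
    (huv : ∀ x ∈ Ω \ E, v x < u x) {x₀ : Eucl n} (hx₀ : x₀ ∈ E) :
    ∃ m > 0, ∃ s > 0, ∀ x ∈ Metric.ball x₀ s \ E, v x + m ≤ u x := by
  have hEc := hE.isCompact.isClosed
  obtain ⟨O, y, hO, hx₀O, hy, hyE, hT⟩ := hE.exists_defining_map (by omega) hx₀
  obtain ⟨ε, hε, c, hc, a, ha, r, hr, hgrow⟩ := exists_linear_growth hΩ hEc hEΩ hx₀ hO hx₀O hy hyE
    hT hcone hP hL hu hv hAu hAv huv
  obtain ⟨c₀, hc₀, hTe⟩ := exists_pos_le_sum_norm_sq (show k < k + 2 by omega) _ hT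
  have hyx₀ : ContDiffAt ℝ 2 y x₀ := hy.contDiffAt (hO.mem_nhds hx₀O)
  have hy₀ : y x₀ = 0 := (hyE x₀ hx₀O).1 hx₀
  have hvx₀ : ContDiffAt ℝ 2 v x₀ := hv.contDiffAt (hΩ.mem_nhds (hEΩ hx₀))
  set D := ‖fderiv ℝ (fderiv ℝ v) x₀‖ with hD
  have hD0 : 0 ≤ D := norm_nonneg (fderiv ℝ (fderiv ℝ v) x₀)
  -- Chosen so that the gain `2εKc₀` exceeds by exactly `1` the worst loss from `v` and from `-2a|x
  -- - x₀|²` over `k + 2` unit vectors.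
  set K := (((k : ℝ) + 2) * (D + ε * (4 * a)) + 1) / (ε * (2 * c₀)) with hK
  have hKpos : 0 < K := by positivity
  have hKeq : ε * (2 * K * c₀) = ((k : ℝ) + 2) * (D + ε * (4 * a)) + 1 := by
    rw [hK]; field_simp
  -- The coefficient `2a`, twice that of the growth estimate, leaves the gap `ε a|x - x₀|²` below
  -- `u`.
  set q : Eucl n → ℝ := fun x => K * ‖y x‖ ^ 2 - 2 * a * ‖x - x₀‖ ^ 2 with hq
  have hqx₀ : ContDiffAt ℝ 2 q x₀ := contDiffAt_quadratic hyx₀ x₀ K (2 * a)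
  set θ : Eucl n → ℝ := fun x => v x + ε * q x with hθ
  have hθC : ContDiffOn ℝ 2 θ (O ∩ Ω) := fun x hx =>
    ((hv.contDiffAt (hΩ.mem_nhds hx.2)).add (contDiffAt_const.mul
      (contDiffAt_quadratic (hy.contDiffAt (hO.mem_nhds hx.1)) x₀ K (2 * a)))).contDiffWithinAt
  have hθ2 : ∀ ξ, secondDeriv θ x₀ ξ = secondDeriv v x₀ ξ
      + ε * (2 * K * ‖fderiv ℝ y x₀ ξ‖ ^ 2 - 2 * (2 * a) * ‖ξ‖ ^ 2) := fun ξ => by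
    rw [hθ, secondDeriv_add hvx₀ (contDiffAt_const.mul hqx₀), secondDeriv_const_mul hqx₀, hq,
      secondDeriv_quadratic hyx₀ hy₀]
  have hsum : ∀ e : Fin (k + 2) → Eucl n, Orthonormal ℝ e →
      1 ≤ ∑ i, secondDeriv θ x₀ (e i) := by
    intro e he
    have h1 : ∀ i, -D ≤ secondDeriv v x₀ (e i) := fun i => by
      have := (abs_le.1 (abs_secondDeriv_le v x₀ (e i))).1
      rwa [he.1 i, one_pow, mul_one] at this
    have h2 := Finset.sum_le_sum fun i (_ : i ∈ Finset.univ) => h1 i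
    have h3 := hTe e he
    simp only [hθ2, he.1, Finset.sum_add_distrib, Finset.sum_sub_distrib, ← Finset.mul_sum,
      one_pow, mul_one, Finset.sum_const, Finset.card_univ, Fintype.card_fin, nsmul_eq_mul] at h2 ⊢
    push_cast at h2 ⊢
    have h4 : ε * (2 * K * c₀) ≤ ε * (2 * K * ∑ i, ‖fderiv ℝ y x₀ (e i)‖ ^ 2) := by gcongr
    linarith
  have hcK : 0 < c / K := by positivity
  have hev : ∀ᶠ x in 𝓝 x₀, ‖y x‖ < c / K :=
    hyx₀.continuousAt.norm.eventually_lt_const (by simpa [hy₀] using hcK)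
  obtain ⟨r', hr', hr's⟩ := Metric.mem_nhds_iff.1
    (Filter.inter_mem hev (Metric.closedBall_mem_nhds x₀ hr))
  obtain ⟨m, hm, s, hs, hms⟩ := hE.exists_add_le_of_lamSum_nonpos hk hkn hx₀ (hO.inter hΩ)
    ⟨hx₀O, hEΩ hx₀⟩ (hu.mono fun x hx => ⟨hx.1.2, hx.2⟩) hθC
    (fun x hx => hlam x ⟨hx.1.2, hx.2⟩) one_pos hsum (mul_pos hε ha) hr' (by
      intro x hx
      have h1 := hgrow x ⟨(hr's hx.1).2, hx.2⟩
      have h2 : ‖y x‖ < c / K := (hr's hx.1).1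
      rw [lt_div_iff₀' hKpos] at h2
      have h3 : ε * (K * ‖y x‖ * ‖y x‖) ≤ ε * (c * ‖y x‖) := by gcongr
      simp only [hθ, hq]
      nlinarith)
  -- Passing from `θ` back to `v` costs only `ε q`, which is continuous and vanishes at `x₀`.
  have hev2 : ∀ᶠ x in 𝓝 x₀, -(m / 2) < ε * q x :=
    (continuousAt_const.mul hqx₀.continuousAt).eventually_const_lt (by
      simp [hq, hy₀, hm])
  obtain ⟨s', hs', hs's⟩ := Metric.mem_nhds_iff.1 hev2
  refine ⟨m / 2, by positivity, min s s', by positivity, fun x hx => ?_⟩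
  have h1 := hms x ⟨Metric.ball_subset_ball (min_le_left _ _) hx.1, hx.2⟩
  have h2 : -(m / 2) < ε * q x := hs's (Metric.ball_subset_ball (min_le_right _ _) hx.1)
  simp only [hθ] at h1
  linarith

end Main

theorem theorem1p6 (n k : ℕ) (hn : 2 ≤ n) (hk : 1 ≤ k) (hkn : k + 2 ≤ n)
    (Ω E : Set (Eucl n)) (hΩ : IsOpen Ω) (hΩc : IsConnected Ω)
    (hE : IsSmoothClosedSubmanifold k E) (hEΩ : E ⊆ Ω)
    (U : Set (Mat n)) (hU : IsOpenInSym U) (hcone : ConeCondition U) (hP : PropertyP k U)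
    (L : Eucl n × ℝ × Eucl n → Mat n) (hL : IsLocLipSym L)
    (u v : Eucl n → ℝ) (hu : ContDiffOn ℝ 2 u (Ω \ E)) (hv : ContDiffOn ℝ 2 v Ω)
    (hlam : ∀ x ∈ Ω \ E, lamSum (k + 2) (hessMat u x) ≤ 0)
    (hAu : ∀ x ∈ Ω \ E, ATilde L u x ∈ closure U)
    (hAv : ∀ x ∈ Ω, ATilde L v x ∈ symMat n \ U)
    (huv : ∀ x ∈ Ω \ E, v x < u x) :
    0 < liminf (fun x => ((u x - v x : ℝ) : EReal)) (nearSet Ω E) := by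
  obtain ⟨m, hm, V, hV, hEV, hmV⟩ : ∃ m > 0, ∃ V, IsOpen V ∧ E ⊆ V ∧
      ∀ x ∈ V \ E, v x + m ≤ u x := by
    refine hE.isCompact.induction_on (p := fun A => ∃ m > 0, ∃ V, IsOpen V ∧ A ⊆ V ∧
      ∀ x ∈ V \ E, v x + m ≤ u x) ⟨1, one_pos, ∅, isOpen_empty, subset_rfl, by simp⟩ ?_ ?_ ?_
    · rintro A A' hA ⟨m, hm, V, hV, hAV, h⟩
      exact ⟨m, hm, V, hV, hA.trans hAV, h⟩
    · rintro A A' ⟨m, hm, V, hV, hAV, h⟩ ⟨m', hm', V', hV', hAV', h'⟩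
      refine ⟨min m m', lt_min hm hm', V ∪ V', hV.union hV', union_subset_union hAV hAV', ?_⟩
      rintro x ⟨hx | hx, hxE⟩
      · have h1 := h x ⟨hx, hxE⟩
        have h2 := min_le_left m m'
        linarith
      · have h1 := h' x ⟨hx, hxE⟩
        have h2 := min_le_right m m'
        linarith
    · intro x₀ hx₀
      obtain ⟨m, hm, s, hs, h⟩ := exists_pos_add_le_near_point hk hkn hΩ hE hEΩ hcone hP hL hu hv
        hlam hAu (fun x hx => (hAv x hx).2) huv hx₀
      exact ⟨_, mem_nhdsWithin_of_mem_nhds (Metric.ball_mem_nhds x₀ hs), m, hm,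
        Metric.ball x₀ s, Metric.isOpen_ball, subset_rfl, h⟩
  -- Compactness of `E` turns the open neighbourhood into a uniform distance, as required by the
  -- filter `nearSet`.
  obtain ⟨η, hη, hηV⟩ := hE.isCompact.exists_thickening_subset_open hV hEV
  refine lt_of_lt_of_le (b := (m : EReal)) (by exact_mod_cast hm) ?_
  refine le_liminf_of_le (by isBoundedDefault) ?_
  have h1 : ∀ᶠ x in nearSet Ω E, Metric.infEDist x E < ENNReal.ofReal η :=
    Filter.Eventually.filter_mono inf_le_left
      ((eventually_lt_nhds (ENNReal.ofReal_pos.2 hη)).comap _)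
  have h2 : ∀ᶠ x in nearSet Ω E, x ∈ Ω \ E :=
    Filter.Eventually.filter_mono inf_le_right (mem_principal_self _)
  filter_upwards [h1, h2] with x hx1 hx2
  have h3 := hmV x ⟨hηV hx1, hx2.2⟩
  exact_mod_cast (by linarith : m ≤ u x - v x)
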